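/- **Setting.** Let $\Gamma\subset\mathbb Z^\nu$ carry the $\ell^1$-distance $d(\cdot,\cdot)$, put a $d$-dimensional spin at each site, and for finite $X\subset\Gamma$ let $\mathcal H_X=\bigotimes_{x\in X}\mathbb C^d$ and $\mathcal A_X=\mathcal B(\mathcal H_X)$, with $\mathcal A_X\subset\mathcal A_\Lambda$ for $X\subset\Lambda$. Let $\Phi$ assign to each finite $X\subset\Gamma$ an element $\Phi(X)=\Phi(X)^*\in\mathcal A_X$, with finite range $r$ (that is, $\Phi(X)=0$ whenever $\operatorname{diam}X>r$) and $\mathfrak j:=\sup_{x\in\Gamma}\sum_{X\ni x}\|\Phi(X)\|<\infty$. Let $N:=\sup_{x\in\Gamma}|\{y\in\Gamma: d(x,y)\le r\}|$. Let $\Lambda\subset\Gamma$ be finite, $L\subset\Lambda$, $L^c:=\Lambda\setminus L$, and let $\partial L\subset\Lambda$ contain every $x\in L$ that has distance at most $r$ to some point of $L^c$ and every $y\in L^c$ that has distance at most $r$ to some point of $L$. Set $H_\Lambda:=\sum_{X\subset\Lambda}\Phi(X)$, $H_{\partial L}:=\sum_{Z\subset\partial L}\Phi(Z)$, and, for $K\in\{L,L^c\}$,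 $H'_K:=\sum_{Z\subset K,\,Z\not\subset\partial L}\Phi(Z)$; put $H':=H'_L+H'_{L^c}$. Assume that the lowest eigenvalue of $H_\Lambda$ is $0$. For $M>\|H_{\partial L}\|$ define the truncated Hamiltonian $$\bar H_\Lambda:=H_{\partial L}+H'\,E^{H'}(-M,M)+M\,E^{H'}[M,\infty),$$ where $E^{H'}(I)$ is the spectral projection of $H'$ for $I\subset\mathbb R$. Let $0=\epsilon_0\le\epsilon_1\le\dots\le\epsilon_{d^{|\Lambda|}-1}$ and $\bar\epsilon_0\le\bar\epsilon_1\le\dots\le\bar\epsilon_{d^{|\Lambda|}-1}$ be the eigenvalues, with multiplicity, of $H_\Lambda$ and $\bar H_\Lambda$, with corresponding orthonormal eigenvectors $\psi_j$ and $\bar\psi_j$. Let $\lambda:=\dfrac1{4\mathfrak j(N+|\partial L|)}$ (read as $0$ in the trivial case $\mathfrak j=0$), and for $0\le j\le d^{|\Lambda|}-1$ let $$\delta_j:=2\sqrt2\,\bigl(M+5\|H_{\partial L}\|+\epsilon_j\bigr)\,e^{-\lambda(M-2\epsilon_j-18\|H_{\partial L}\|)}.$$ **Theorem.** (i) For every $0\le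 j\le d^{|\Lambda|}-1$, $\ \epsilon_j-2\delta_j\le\bar\epsilon_j\le\epsilon_j$. (ii) Suppose $d^{|\Lambda|}\ge2$, let $\Delta:=\epsilon_1$ and $$\eta:=2\sqrt2\,\bigl(M+\|H_{\partial L}\|+\Delta\bigr)\,e^{-\lambda(M-4\delta_0-10\|H_{\partial L}\|)}.$$ If $\Delta>2\delta_0+\eta$, then $$|\langle\psi_0,\bar\psi_0\rangle|^2\ge1-\left(\frac{2\delta_0+\eta}{\Delta}\right)^2.$$ In particular, $\delta_j$ and $\eta$ depend on $\Lambda$ only through $\epsilon_j$ (respectively $\epsilon_0$ and $\Delta$). -/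

import Mathlib

open scoped Matrix.Norms.L2Operator

noncomputable section

namespace SpinSystem

/-- The `ℓ¹`-distance on `ℤ^ν`. -/
def latticeDist {ν : ℕ} (x y : Fin ν → ℤ) : ℕ := ∑ j, (x j - y j).natAbs

/-- The `ℓ¹`-diameter `max_{x,y ∈ X} d(x,y)` of a finite subset of the lattice (`0` for the
empty set). -/
def latticeDiam {ν : ℕ} {Γ : Set (Fin ν → ℤ)} (X : Finset Γ) : ℕ :=
  X.sup fun x => X.sup fun y => latticeDist x.1 y.1

/-- Classical spin configurations on `Λ`. They label the product basis of
`ℋ_Λ = ⨂_{x ∈ Λ} ℂ^d`, which is therefore `EuclideanSpace ℂ (Config d Λ)`. -/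
abbrev Config {V : Type*} (d : ℕ) (Λ : Finset V) : Type _ := Λ → Fin d

/-- The Hilbert space `ℋ_Λ = ⨂_{x ∈ Λ} ℂ^d`, in its product basis. -/
abbrev Hilb {V : Type*} (d : ℕ) (Λ : Finset V) : Type _ := EuclideanSpace ℂ (Config d Λ)

/-- The algebra `𝒜_Λ = ⨂_{x ∈ Λ} M_d(ℂ) = ℬ(ℋ_Λ)`: operators on `ℋ_Λ`, written as matrices in
the product basis. Its norm is the operator norm on `ℋ_Λ` (the scoped instance of
`Matrix.Norms.L2Operator`). -/
abbrev Obs {V : Type*} (d : ℕ) (Λ : Finset V) : Type _ :=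
  Matrix (Config d Λ) (Config d Λ) ℂ

/-- The canonical inclusion `𝒜_X ⊆ 𝒜_Λ`, `A ↦ A ⊗ 1_{Λ ∖ X}`, for `X ⊆ Λ`. -/
def embed {V : Type*} [DecidableEq V] {d : ℕ} {X Λ : Finset V} (h : X ⊆ Λ) (A : Obs d X) :
    Obs d Λ :=
  Matrix.of fun σ τ =>
    if ∀ z : Λ, z.1 ∉ X → σ z = τ z then
      A (fun z => σ ⟨z.1, h z.2⟩) (fun z => τ ⟨z.1, h z.2⟩)
    else 0

/-- An interaction on `Γ ⊆ ℤ^ν`: a self-adjoint `Φ(X) ∈ 𝒜_X` for every finite `X ⊆ Γ`. -/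
structure Interaction {ν : ℕ} (Γ : Set (Fin ν → ℤ)) (d : ℕ) where
  /-- the interaction term `Φ(X)` -/
  val : (X : Finset Γ) → Obs d X
  /-- `Φ(X) = Φ(X)*` -/
  isHermitian : ∀ X, (val X).IsHermitian

namespace Interaction

variable {ν d : ℕ} {Γ : Set (Fin ν → ℤ)} (Φ : Interaction Γ d)

/-- Finite range `r`: `Φ(X) = 0` whenever `diam X > r`. -/
def HasRange (r : ℝ) : Prop := ∀ X : Finset Γ, r < (latticeDiam X : ℝ) → Φ.val X = 0

/-- The interaction strength `𝔧 = sup_{x ∈ Γ} ∑_{X ∋ x} ‖Φ(X)‖ ∈ [0, ∞]`. -/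
def strength : ENNReal := ⨆ x : Γ, ∑' X : {X : Finset Γ // x ∈ X}, ‖Φ.val X.1‖ₑ

/-- The sum `∑_{Z ∈ S, Z ⊆ Λ} Φ(Z)`, as an element of `𝒜_Λ`. -/
def partialSum (Λ : Finset Γ) (S : Finset (Finset Γ)) : Obs d Λ :=
  ∑ Z ∈ S, if h : Z ⊆ Λ then embed h (Φ.val Z) else 0

/-- The Hamiltonian `H_Λ = ∑_{X ⊆ Λ} Φ(X) ∈ 𝒜_Λ`. -/
def hamiltonian (Λ : Finset Γ) : Obs d Λ := Φ.partialSum Λ Λ.powerset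

/-- `H_{∂L} = ∑_{Z ⊆ ∂L} Φ(Z)`, as an element of `𝒜_Λ`; here `B = ∂L ⊆ Λ`. -/
def boundaryHam (Λ B : Finset Γ) : Obs d Λ := Φ.partialSum Λ B.powerset

/-- For `B = ∂L` and a region `K` (to be used for `K = L` and `K = L^c`), the Hamiltonian
`H'_K = ∑_{Z ⊆ K, Z ∩ (∂L)^c ≠ ∅} Φ(Z)`, as an element of `𝒜_Λ`. -/
def bulkHam (Λ B K : Finset Γ) : Obs d Λ := Φ.partialSum Λ (K.powerset.filter fun Z => ¬ Z ⊆ B)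

end Interaction

/-- `N = sup_{x ∈ Γ} |{y ∈ Γ : d(x,y) ≤ r}|`. The supremum is over a bounded set of naturals,
since every ball has at most as many points as a ball of radius `r` in `ℤ^ν`. -/
def ballSize {ν : ℕ} (Γ : Set (Fin ν → ℤ)) (r : ℝ) : ℕ :=
  ⨆ x : Γ, Set.ncard {y : Γ | (latticeDist x.1 y.1 : ℝ) ≤ r}

/-- The interaction boundary between `L ⊆ Λ` and its complement `L^c = Λ ∖ L`:
`{x ∈ L : d(x, L^c) ≤ r} ∪ {y ∈ L^c : d(y, L) ≤ r}`. -/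
def interactionBoundary {ν : ℕ} {Γ : Set (Fin ν → ℤ)} (r : ℝ) (Λ L : Finset Γ) : Set Γ :=
  {x | x ∈ L ∧ ∃ y ∈ Λ \ L, (latticeDist x.1 y.1 : ℝ) ≤ r} ∪
  {y | y ∈ Λ \ L ∧ ∃ x ∈ L, (latticeDist y.1 x.1 : ℝ) ≤ r}

/-- The spectral projection `E^A(I)` of a Hermitian matrix `A`, i.e. `1_I(A)`. The spectrum of `A`
is finite, so every function is continuous on it and the functional calculus gives the sum of the
projections `|ψ_j⟩⟨ψ_j|` onto the eigenvectors with eigenvalue in `I`. -/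
def specProj {n : Type*} [Fintype n] [DecidableEq n] (A : Matrix n n ℂ) (I : Set ℝ) :
    Matrix n n ℂ := cfc (I.indicator (fun _ => (1 : ℝ))) A

/-- The energy truncation `A E^A(-M,M) + M E^A[M,∞)`. -/
def energyTruncation {n : Type*} [Fintype n] [DecidableEq n] (M : ℝ) (A : Matrix n n ℂ) :
    Matrix n n ℂ :=
  A * specProj A (Set.Ioo (-M) M) + (M : ℂ) • specProj A (Set.Ici M)

/-- The eigenvalues of an `N`-dimensional operator `A`, in increasing order and with multiplicity,
with corresponding orthonormal eigenvectors. As `N` is the dimension, `ψ` is a basis. -/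
structure IsOrderedEigensystem {V : Type*} [DecidableEq V] {d : ℕ} {Λ : Finset V} (A : Obs d Λ)
    (ε : Fin (d ^ Λ.card) → ℝ) (ψ : Fin (d ^ Λ.card) → Hilb d Λ) : Prop where
  monotone : Monotone ε
  orthonormal : Orthonormal ℂ ψ
  eigen : ∀ j, Matrix.toEuclideanLin A (ψ j) = (ε j : ℂ) • ψ j

namespace Interaction

variable {ν d : ℕ} {Γ : Set (Fin ν → ℤ)} (Φ : Interaction Γ d)

/-- The energy-truncated Hamiltonian `H_{∂L} + \overline{H'_L + H'_{L^c}}`, with `B = ∂L` and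
`L^c = Λ ∖ L`. -/
def truncatedHam (Λ L B : Finset Γ) (M : ℝ) : Obs d Λ :=
  Φ.boundaryHam Λ B + energyTruncation M (Φ.bulkHam Λ B L + Φ.bulkHam Λ B (Λ \ L))

/-- `‖H_{∂L}‖`, taken in `𝒜_{∂L}`. Since `𝒜_{∂L} ⊆ 𝒜_Λ` is isometric this is also the norm in
`𝒜_Λ`; written this way, it visibly does not involve `Λ`. -/
def boundaryNorm (B : Finset Γ) : ℝ := ‖Φ.hamiltonian B‖

/-- `λ = 1 / (4 𝔧 (N + |∂L|))`. -/
def rate (r : ℝ) (B : Finset Γ) : ℝ :=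
  1 / (4 * Φ.strength.toReal * ((ballSize Γ r : ℝ) + (B.card : ℝ)))

/-- The error `2√2 (M + 5‖H_{∂L}‖ + e) exp(-λ (M - 2e - 18‖H_{∂L}‖))`; its value at `e = ε_j`
is `δ_j`. -/
def deltaErr (r : ℝ) (B : Finset Γ) (M e : ℝ) : ℝ :=
  2 * √2 * (M + 5 * Φ.boundaryNorm B + e) *
    Real.exp (-Φ.rate r B * (M - 2 * e - 18 * Φ.boundaryNorm B))

/-- The error `η(e, δ) = 2√2 (M + ‖H_{∂L}‖ + δ) exp(-λ (M - 2e - 10‖H_{∂L}‖))`. -/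
def etaErr (r : ℝ) (B : Finset Γ) (M e δ : ℝ) : ℝ :=
  2 * √2 * (M + Φ.boundaryNorm B + δ) *
    Real.exp (-Φ.rate r B * (M - 2 * e - 10 * Φ.boundaryNorm B))

end Interaction

end SpinSystem

end

/-!
Write `a = H_{∂L}`, `b = ‖H_{∂L}‖`, `K = H'`. By the finite range, every interaction term sits
inside `∂L`, inside `L` or inside `L^c`, so `H_Λ = a + K` (`hamiltonian_eq_boundaryHam_add`). As
`H_Λ ≥ 0` and `M > b`, the spectrum of `K` lies above `-M`, and the truncated Hamiltonian is `a + min(K, M)`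
(`energyTruncation_eq_cutoff`). The whole proof rests on one estimate: if `φ` is a combination of
eigenvectors of `a + min(K, M)` with energies at most `e`, and `Q` is the spectral projection of `K`
onto `[M, ∞)`, then `‖Qφ‖ ≤ e^{-λ (M - e - 3b)} ‖φ‖` (`norm_highProj_apply_le`).

This estimate uses locality only through the bound `‖e^{tK} a e^{-tK}‖ ≤ 2b` for `0 ≤ t ≤ λ`, which
comes from the commutator series: the `m`-fold commutator of `K` with `a` has norm at most
`m! (2𝔧(N + |∂L|))^m b`, because each step enlarges the support by at most `N` sites
(`norm_adCLM_pow_apply_le`, `norm_exp_conj_boundaryHam_le`). Replacing `K` by `G = min(K, M)` costs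
only a block decomposition and gives `‖e^{tG} a e^{-tG}‖ ≤ 3b` (`norm_exp_cutoff_conj_le`). By
Grönwall's inequality `‖e^{λG} e^{-λ(a + G)}‖ ≤ e^{3bλ}` (`norm_exp_mul_exp_neg_add_le`), and the
estimate follows by writing `Q = Q e^{-λG} · e^{λG} e^{-λ(a + G)} · e^{λ(a + G)}`.

The upper bound on the eigenvalues is monotonicity, from `min(K, M) ≤ K`. For the lower bound, the
low-energy space of the truncated Hamiltonian is projected by `1 - Q` to a trial space for `H_Λ`;
for a unit vector `φ` this raises the energy by at most `2b ‖Qφ‖` (`re_inner_lowProj_le`) and lowers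
the squared norm by `‖Qφ‖²` (`eigenvalue_sub_le_truncated`). For the overlap,
`H_Λ (1 - Q)φ = e φ - (a + M) Qφ` when `φ` is an eigenvector of the truncated Hamiltonian, so the
component of `(1 - Q)φ` orthogonal to the ground state is small by the spectral gap
(`one_sub_sq_le_overlap`). The resulting errors are smaller than the stated `δ_j` and `η`.
-/

noncomputable section

namespace SpinSystem

/-! ### Conjugation by exponentials and iterated commutators -/

section ExpConj

variable {A : Type*} [NormedRing A] [NormedAlgebra ℝ A]

/-- The commutator map `a ↦ K a - a K`, as a bounded operator. -/
def adCLM (K : A) : A →L[ℝ] A :=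
  ContinuousLinearMap.mul ℝ A K - (ContinuousLinearMap.mul ℝ A).flip K

@[simp]
theorem adCLM_apply (K a : A) : adCLM K a = K * a - a * K := by
  simp [adCLM]

variable [CompleteSpace A]

theorem exp_neg_mul_exp (K : A) : NormedSpace.exp (-K) * NormedSpace.exp K = 1 := by
  let _ : NormedAlgebra ℚ A := NormedAlgebra.restrictScalars ℚ ℝ A
  rw [← NormedSpace.exp_add_of_commute (Commute.refl K).neg_left]
  simp

theorem exp_mul_exp_neg (K : A) : NormedSpace.exp K * NormedSpace.exp (-K) = 1 := by
  simpa using exp_neg_mul_exp (-K)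

theorem hasDerivAt_exp_neg_smul (K : A) (t : ℝ) :
    HasDerivAt (fun s : ℝ => NormedSpace.exp (-(s • K))) (-(K * NormedSpace.exp (-(t • K)))) t := by
  have h := hasDerivAt_exp_smul_const' (𝕂 := ℝ) (-K) t
  simpa [smul_neg, neg_mul] using h

/-- Conjugation by `e^{tK}` is the exponential of the commutator map: both sides satisfy the same
linear differential equation. -/
theorem exp_adCLM_apply (K a : A) (t : ℝ) :
    NormedSpace.exp (t • adCLM K) a =
      NormedSpace.exp (t • K) * a * NormedSpace.exp (-(t • K)) := by
  set G : ℝ → A := fun s =>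
    NormedSpace.exp (-(s • K)) * (NormedSpace.exp (s • adCLM K) a) * NormedSpace.exp (s • K)
    with hG
  have hd : ∀ s, HasDerivAt G 0 s := by
    intro s
    have h1 := hasDerivAt_exp_neg_smul K s
    have h2 : HasDerivAt (fun u : ℝ => NormedSpace.exp (u • adCLM K) a)
        (adCLM K (NormedSpace.exp (s • adCLM K) a)) s := by
      have := (hasDerivAt_exp_smul_const' (𝕂 := ℝ) (adCLM K) s).clm_apply (hasDerivAt_const s a)
      simpa using this
    have h3 := hasDerivAt_exp_smul_const' (𝕂 := ℝ) K s
    have hc : NormedSpace.exp (-(s • K)) * K = K * NormedSpace.exp (-(s • K)) := by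
      let _ : NormedAlgebra ℚ A := NormedAlgebra.restrictScalars ℚ ℝ A
      exact (((Commute.refl K).smul_right s).neg_right.exp_right).eq.symm
    refine ((h1.mul h2).mul h3).congr_deriv ?_
    simp only [Pi.mul_apply, adCLM_apply, ← hc]
    generalize NormedSpace.exp (-(s • K)) = x, NormedSpace.exp (s • K) = y,
      NormedSpace.exp (s • adCLM K) a = z
    noncomm_ring
  have hconst : G t = G 0 :=
    is_const_of_deriv_eq_zero (fun s => (hd s).differentiableAt) (fun s => (hd s).deriv) t 0
  have h0 : G 0 = a := by
    have : NormedSpace.exp ((0 : ℝ) • adCLM K) = 1 := by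
      rw [show (0 : ℝ) • adCLM K = 0 by ext; simp, NormedSpace.exp_zero]
    simp [hG, this]
  rw [h0] at hconst
  conv_rhs => rw [← hconst, hG]
  simp only [← mul_assoc, exp_mul_exp_neg, one_mul]
  rw [mul_assoc, exp_mul_exp_neg, mul_one]

/-- The commutator series is dominated by the geometric series of ratio `t c ≤ 1 / 2`. -/
theorem norm_exp_conj_le {K a : A} {c C t : ℝ}
    (h : ∀ n : ℕ, ‖(adCLM K ^ n) a‖ ≤ n.factorial * c ^ n * C)
    (ht : 0 ≤ t) (hc : 0 ≤ c) (htc : t * c ≤ 1 / 2) :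
    ‖NormedSpace.exp (t • K) * a * NormedSpace.exp (-(t • K))‖ ≤ 2 * C := by
  have hC : 0 ≤ C := by simpa using (norm_nonneg _).trans (h 0)
  rw [← exp_adCLM_apply]
  have hs := NormedSpace.exp_series_hasSum_exp' (𝕂 := ℝ) (t • adCLM K)
  have hs' := hs.mapL (ContinuousLinearMap.apply ℝ A a)
  refine hs'.norm_le_of_bounded (hasSum_geometric_two.mul_right C) fun n => ?_
  have hf : (0 : ℝ) < n.factorial := by exact_mod_cast n.factorial_pos
  have h1 : (ContinuousLinearMap.apply ℝ A a) (((n.factorial : ℝ)⁻¹) • (t • adCLM K) ^ n)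
      = ((n.factorial : ℝ)⁻¹ * t ^ n) • (adCLM K ^ n) a := by
    have h2 : ∀ m : ℕ, ((t • adCLM K) ^ m) a = t ^ m • (adCLM K ^ m) a := by
      intro m
      induction m with
      | zero => simp
      | succ m ih =>
        rw [pow_succ', pow_succ' (adCLM K), mul_apply_eq_comp,
          mul_apply_eq_comp, ih, map_smul, smul_apply, smul_smul,
          pow_succ]
    rw [ContinuousLinearMap.apply_apply, smul_apply, h2, smul_smul]
  rw [h1, norm_smul, Real.norm_of_nonneg (by positivity)]
  calc ((n.factorial : ℝ)⁻¹ * t ^ n) * ‖(adCLM K ^ n) a‖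
      ≤ ((n.factorial : ℝ)⁻¹ * t ^ n) * (n.factorial * c ^ n * C) := by gcongr; exact h n
    _ = (t * c) ^ n * C := by rw [mul_pow]; field_simp
    _ ≤ (1 / 2) ^ n * C := by gcongr

end ExpConj

/-! ### Functional calculus of the bulk Hamiltonian and its cutoff -/

section Cfc

variable {n : Type*} [Fintype n] [DecidableEq n]

theorem cfc_matrix_mul (K : Matrix n n ℂ) (f g : ℝ → ℝ) :
    cfc f K * cfc g K = cfc (fun x => f x * g x) K :=
  (cfc_mul f g K (K.finite_real_spectrum.continuousOn f)
    (K.finite_real_spectrum.continuousOn g)).symm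

theorem exp_smul_cfc {K : Matrix n n ℂ} (hK : IsSelfAdjoint K) (g : ℝ → ℝ) (s : ℝ) :
    NormedSpace.exp (s • cfc g K) = cfc (fun x => Real.exp (s * g x)) K := by
  have hg := K.finite_real_spectrum.continuousOn g
  rw [← cfc_const_mul s g K hg,
    ← CFC.real_exp_eq_normedSpace_exp (cfc_predicate _ K),
    ← cfc_comp' Real.exp (fun x => s * g x) K (Real.continuous_exp.continuousOn)
      (K.finite_real_spectrum.continuousOn _) hK]

theorem exp_smul_eq_cfc {K : Matrix n n ℂ} (hK : IsSelfAdjoint K) (s : ℝ) :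
    NormedSpace.exp (s • K) = cfc (fun x => Real.exp (s * x)) K := by
  conv_lhs => rw [← cfc_id ℝ K hK]
  exact exp_smul_cfc hK _ s

/-- The truncation `min(K, M)` of a self-adjoint matrix. -/
def cutoff (M : ℝ) (K : Matrix n n ℂ) : Matrix n n ℂ := cfc (fun x => min x M) K

/-- The spectral projection of `K` onto energies below `M`. -/
def lowProj (M : ℝ) (K : Matrix n n ℂ) : Matrix n n ℂ := specProj K (Set.Iio M)

/-- The spectral projection of `K` onto energies at least `M`. -/
def highProj (M : ℝ) (K : Matrix n n ℂ) : Matrix n n ℂ := specProj K (Set.Ici M)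

theorem lowProj_add_highProj {K : Matrix n n ℂ} (hK : IsSelfAdjoint K) (M : ℝ) :
    lowProj M K + highProj M K = 1 := by
  rw [lowProj, highProj, specProj, specProj, ← cfc_add _ _ _ (K.finite_real_spectrum.continuousOn _)
    (K.finite_real_spectrum.continuousOn _), ← cfc_one ℝ K hK]
  congr 1
  ext x
  by_cases h : x < M
  · simp [h]
  · simp [h, not_lt.mp h]

theorem norm_specProj_le (K : Matrix n n ℂ) (I : Set ℝ) : ‖specProj K I‖ ≤ 1 := by
  refine norm_cfc_le zero_le_one fun x _ => ?_
  by_cases h : x ∈ I <;> simp [h]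

/-- Conjugation by the exponential of a truncation costs only the constant `3`: below the cutoff it
agrees with the conjugation by `e^{tK}`, above it it is the conjugation by a scalar, and between
the two the factor `e^{t (min(x, M) - x)}` is at most `1`. -/
theorem norm_exp_cutoff_conj_le {K a : Matrix n n ℂ} (hK : IsSelfAdjoint K) {b t M : ℝ}
    (ht : 0 ≤ t) (ha : ‖a‖ ≤ b)
    (hconj : ‖NormedSpace.exp (t • K) * a * NormedSpace.exp (-(t • K))‖ ≤ 2 * b) :
    ‖NormedSpace.exp (t • cutoff M K) * a * NormedSpace.exp (-(t • cutoff M K))‖ ≤ 3 * b := by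
  have hb : 0 ≤ b := (norm_nonneg a).trans ha
  have hsplit : NormedSpace.exp (t • cutoff M K) * a * NormedSpace.exp (-(t • cutoff M K)) =
      cfc (fun x => Real.exp (t * min x M) * Real.exp (-t * x)) K *
        (NormedSpace.exp (t • K) * a * NormedSpace.exp (-(t • K))) * lowProj M K +
      cfc (fun x => Real.exp (t * min x M) * Real.exp (-t * M)) K * a * highProj M K := by
    have h1 : cfc (fun x => Real.exp (t * min x M) * Real.exp (-t * x)) K *
        NormedSpace.exp (t • K) = NormedSpace.exp (t • cutoff M K) := by
      rw [exp_smul_eq_cfc hK, cfc_matrix_mul, cutoff, exp_smul_cfc hK]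
      congr 1
      ext x
      rw [← Real.exp_add, ← Real.exp_add]
      congr 1
      ring
    have h2 : NormedSpace.exp (-(t • K)) * lowProj M K =
        NormedSpace.exp (-(t • cutoff M K)) * lowProj M K := by
      rw [← neg_smul, ← neg_smul, exp_smul_eq_cfc hK, cutoff, exp_smul_cfc hK, lowProj, specProj,
        cfc_matrix_mul, cfc_matrix_mul]
      congr 1
      ext x
      by_cases h : x < M
      · simp [h, min_eq_left h.le]
      · simp [h]
    have h3 : cfc (fun x => Real.exp (t * min x M) * Real.exp (-t * M)) K * a * highProj M K =
        NormedSpace.exp (t • cutoff M K) * a *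
          (NormedSpace.exp (-(t • cutoff M K)) * highProj M K) := by
      rw [← neg_smul, cutoff, exp_smul_cfc hK, exp_smul_cfc hK, highProj, specProj, cfc_matrix_mul]
      have h4 : cfc (fun x => Real.exp (-t * min x M) *
          (Set.Ici M).indicator (fun _ => (1 : ℝ)) x) K =
          Real.exp (-t * M) • cfc ((Set.Ici M).indicator (fun _ => (1 : ℝ))) K := by
        rw [← cfc_const_mul _ _ K (K.finite_real_spectrum.continuousOn _)]
        congr 1
        ext x
        by_cases h : M ≤ x
        · simp [h]
        · simp [h]
      have h5 : cfc (fun x => Real.exp (t * min x M) * Real.exp (-t * M)) K =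
          Real.exp (-t * M) • cfc (fun x => Real.exp (t * min x M)) K := by
        rw [← cfc_const_mul _ _ K (K.finite_real_spectrum.continuousOn _)]
        congr 1
        ext x
        ring
      rw [h4, h5]
      simp
    rw [h3]
    calc _ = NormedSpace.exp (t • cutoff M K) * a * NormedSpace.exp (-(t • cutoff M K)) *
          (lowProj M K + highProj M K) := by rw [lowProj_add_highProj hK, mul_one]
      _ = NormedSpace.exp (t • cutoff M K) * a * (NormedSpace.exp (-(t • cutoff M K)) * lowProj M K)
          + NormedSpace.exp (t • cutoff M K) * a *
            (NormedSpace.exp (-(t • cutoff M K)) * highProj M K) := by noncomm_ring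
      _ = _ := by
        rw [← h2, ← h1]
        noncomm_ring
  have hn1 : ‖cfc (fun x => Real.exp (t * min x M) * Real.exp (-t * x)) K‖ ≤ 1 := by
    refine norm_cfc_le zero_le_one fun x _ => ?_
    rw [← Real.exp_add, Real.norm_of_nonneg (Real.exp_pos _).le, Real.exp_le_one_iff]
    nlinarith [min_le_left x M]
  have hn2 : ‖cfc (fun x => Real.exp (t * min x M) * Real.exp (-t * M)) K‖ ≤ 1 := by
    refine norm_cfc_le zero_le_one fun x _ => ?_
    rw [← Real.exp_add, Real.norm_of_nonneg (Real.exp_pos _).le, Real.exp_le_one_iff]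
    nlinarith [min_le_right x M]
  rw [hsplit]
  have hP := norm_specProj_le K (Set.Iio M)
  have hQ := norm_specProj_le K (Set.Ici M)
  calc _ ≤ 1 * (2 * b) * 1 + 1 * b * 1 := by
        refine (norm_add_le _ _).trans (add_le_add ?_ ?_)
        · refine (norm_mul_le _ _).trans (mul_le_mul ((norm_mul_le _ _).trans ?_) hP
            (norm_nonneg _) (by positivity))
          exact mul_le_mul hn1 hconj (norm_nonneg _) zero_le_one
        · refine (norm_mul_le _ _).trans (mul_le_mul ((norm_mul_le _ _).trans ?_) hQ
            (norm_nonneg _) (by positivity))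
          exact mul_le_mul hn2 ha (norm_nonneg _) zero_le_one
    _ = 3 * b := by ring

/-- Grönwall: `U(s) = e^{sG} e^{-s(a + G)}` solves `U' = -(e^{sG} a e^{-sG}) U`, `U(0) = 1`. -/
theorem norm_exp_mul_exp_neg_add_le {a G : Matrix n n ℂ} {c l : ℝ} (hl : 0 ≤ l)
    (h : ∀ t, 0 ≤ t → t ≤ l →
      ‖NormedSpace.exp (t • G) * a * NormedSpace.exp (-(t • G))‖ ≤ c) :
    ‖NormedSpace.exp (l • G) * NormedSpace.exp (-(l • (a + G)))‖ ≤ Real.exp (c * l) := by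
  set U : ℝ → Matrix n n ℂ := fun s =>
    NormedSpace.exp (s • G) * NormedSpace.exp (-(s • (a + G))) with hU
  have hd : ∀ s, HasDerivAt U
      (-(NormedSpace.exp (s • G) * a * NormedSpace.exp (-(s • G))) * U s) s := by
    intro s
    have h1 := hasDerivAt_exp_smul_const (𝕂 := ℝ) G s
    have h2 := hasDerivAt_exp_neg_smul (a + G) s
    refine (h1.mul h2).congr_deriv ?_
    have : NormedSpace.exp (-(s • G)) * U s = NormedSpace.exp (-(s • (a + G))) := by
      rw [hU]
      simp only [← mul_assoc, exp_neg_mul_exp, one_mul]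
    rw [neg_mul, mul_assoc _ _ (U s), this]
    noncomm_ring
  have h0 : ‖U 0‖ ≤ 1 := by
    have : U 0 = 1 := by simp [hU]
    rw [this]
    cases isEmpty_or_nonempty n
    · rw [Subsingleton.elim (1 : Matrix n n ℂ) 0, norm_zero]
      exact zero_le_one
    · exact CStarRing.norm_one.le
  have := norm_le_gronwallBound_of_norm_deriv_right_le (f := U)
    (f' := fun s => -(NormedSpace.exp (s • G) * a * NormedSpace.exp (-(s • G))) * U s)
    (δ := 1) (K := c) (ε := 0) (a := 0) (b := l)
    (fun s _ => (hd s).continuousAt.continuousWithinAt) (fun s _ => (hd s).hasDerivWithinAt) h0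
    (fun s hs => by
      rw [add_zero]
      refine (norm_mul_le _ _).trans ?_
      rw [norm_neg]
      exact mul_le_mul_of_nonneg_right (h s hs.1 hs.2.le) (norm_nonneg _)) l ⟨hl, le_rfl⟩
  rwa [gronwallBound_ε0, one_mul, sub_zero] at this

end Cfc

/-! ### Matrices as operators on Euclidean space -/

section Operators

variable {n : Type*} [Fintype n] [DecidableEq n]

/-- The operator on `EuclideanSpace ℂ n` with matrix `A`. -/
abbrev op (A : Matrix n n ℂ) : EuclideanSpace ℂ n →L[ℂ] EuclideanSpace ℂ n :=
  Matrix.toEuclideanCLM (𝕜 := ℂ) A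

theorem op_mul_apply (A C : Matrix n n ℂ) (v : EuclideanSpace ℂ n) :
    op (A * C) v = op A (op C v) := by
  simp [op, map_mul]

theorem op_add_apply (A C : Matrix n n ℂ) (v : EuclideanSpace ℂ n) :
    op (A + C) v = op A v + op C v := by
  simp [op, map_add]

theorem op_one_apply (v : EuclideanSpace ℂ n) : op (1 : Matrix n n ℂ) v = v := by
  simp [op, map_one]

theorem op_real_smul_apply (c : ℝ) (A : Matrix n n ℂ) (v : EuclideanSpace ℂ n) :
    op (c • A) v = (c : ℂ) • op A v := by
  rw [← Complex.coe_smul c A, op, map_smul, smul_apply]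

theorem norm_op_apply_le (A : Matrix n n ℂ) (v : EuclideanSpace ℂ n) :
    ‖op A v‖ ≤ ‖A‖ * ‖v‖ := by
  rw [← Matrix.l2_opNorm_toEuclideanCLM A]
  exact (op A).le_opNorm v

theorem inner_op_left {A : Matrix n n ℂ} (hA : IsSelfAdjoint A) (v w : EuclideanSpace ℂ n) :
    inner ℂ (op A v) w = inner ℂ v (op A w) := by
  have h : IsSelfAdjoint (op A) := hA.map (Matrix.toEuclideanCLM (𝕜 := ℂ) (n := n))
  rw [← ContinuousLinearMap.adjoint_inner_left, h.adjoint_eq]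

theorem re_inner_op_cfc_nonneg (K : Matrix n n ℂ) {f : ℝ → ℝ} (hf : ∀ x, 0 ≤ f x)
    (v : EuclideanSpace ℂ n) : 0 ≤ (inner ℂ v (op (cfc f K) v)).re := by
  have h : cfc f K = cfc (fun x => √(f x)) K * cfc (fun x => √(f x)) K := by
    rw [cfc_matrix_mul]
    congr 1
    ext x
    exact (Real.mul_self_sqrt (hf x)).symm
  rw [h, op_mul_apply, ← inner_op_left (cfc_predicate _ K)]
  exact inner_self_nonneg (𝕜 := ℂ)

theorem op_exp_apply_eigenvector {A : Matrix n n ℂ} {v : EuclideanSpace ℂ n} {e : ℝ}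
    (h : op A v = (e : ℂ) • v) (s : ℝ) :
    op (NormedSpace.exp (s • A)) v = (Real.exp (s * e) : ℂ) • v := by
  have hpow : ∀ k : ℕ, op ((s • A) ^ k) v = (((s * e) ^ k : ℝ) : ℂ) • v := by
    intro k
    induction k with
    | zero => simp
    | succ k ih =>
      rw [pow_succ', op_mul_apply, ih, map_smul, op_real_smul_apply, h, smul_smul, smul_smul]
      congr 1
      push_cast
      ring
  have h1 := NormedSpace.exp_series_hasSum_exp' (𝕂 := ℝ) (s • A)
  let ev : Matrix n n ℂ →ₗ[ℝ] EuclideanSpace ℂ n :=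
    { toFun := fun C => op C v
      map_add' := fun C D => op_add_apply C D v
      map_smul' := fun c C => by
        rw [op_real_smul_apply, RingHom.id_apply, Complex.coe_smul] }
  have h2 := h1.mapL (LinearMap.toContinuousLinearMap ev)
  have h3 := (NormedSpace.exp_series_hasSum_exp' (𝕂 := ℝ) (s * e)).smul_const v
  rw [← Real.exp_eq_exp_ℝ] at h3
  have h4 : op (NormedSpace.exp (s • A)) v = Real.exp (s * e) • v := by
    refine h2.unique (h3.congr_fun ?_)
    intro k
    change op _ v = _
    rw [op_real_smul_apply, hpow, ← Complex.coe_smul, smul_smul]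
    simp
  rw [h4, Complex.coe_smul]

end Operators

/-! ### Eigenbases, quadratic forms and the dimension count -/

section Eigenbasis

variable {n ι : Type*} [Fintype n] [DecidableEq n] [Fintype ι]
  {β : OrthonormalBasis ι ℂ (EuclideanSpace ℂ n)} {A : Matrix n n ℂ} {ε : ι → ℝ}

theorem inner_eigenvector_op (hA : IsSelfAdjoint A) (hβ : ∀ i, op A (β i) = (ε i : ℂ) • β i)
    (i : ι) (v : EuclideanSpace ℂ n) :
    inner ℂ (β i) (op A v) = (ε i : ℂ) * inner ℂ (β i) v := by
  rw [← inner_op_left hA, hβ, inner_smul_left, Complex.conj_ofReal]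

theorem re_inner_op_eq_sum (hA : IsSelfAdjoint A) (hβ : ∀ i, op A (β i) = (ε i : ℂ) • β i)
    (v : EuclideanSpace ℂ n) :
    (inner ℂ v (op A v)).re = ∑ i, ε i * ‖inner ℂ (β i) v‖ ^ 2 := by
  rw [← β.sum_inner_mul_inner v, Complex.re_sum]
  refine Finset.sum_congr rfl fun i _ => ?_
  rw [inner_eigenvector_op hA hβ, mul_left_comm, ← inner_conj_symm, Complex.conj_mul',
    ← Complex.ofReal_pow, ← Complex.ofReal_mul, Complex.ofReal_re]

theorem le_re_inner_op (hA : IsSelfAdjoint A) (hβ : ∀ i, op A (β i) = (ε i : ℂ) • β i) {e : ℝ}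
    {v : EuclideanSpace ℂ n} (h : ∀ i, ε i < e → inner ℂ (β i) v = 0) :
    e * ‖v‖ ^ 2 ≤ (inner ℂ v (op A v)).re := by
  rw [re_inner_op_eq_sum hA hβ, ← β.sum_sq_norm_inner_right v, Finset.mul_sum]
  refine Finset.sum_le_sum fun i _ => ?_
  by_cases hi : ε i < e
  · simp [h i hi]
  · exact mul_le_mul_of_nonneg_right (not_lt.mp hi) (sq_nonneg _)

theorem re_inner_op_le (hA : IsSelfAdjoint A) (hβ : ∀ i, op A (β i) = (ε i : ℂ) • β i) {e : ℝ}
    {v : EuclideanSpace ℂ n} (h : ∀ i, e < ε i → inner ℂ (β i) v = 0) :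
    (inner ℂ v (op A v)).re ≤ e * ‖v‖ ^ 2 := by
  rw [re_inner_op_eq_sum hA hβ, ← β.sum_sq_norm_inner_right v, Finset.mul_sum]
  refine Finset.sum_le_sum fun i _ => ?_
  by_cases hi : e < ε i
  · simp [h i hi]
  · exact mul_le_mul_of_nonneg_right (not_lt.mp hi) (sq_nonneg _)

theorem norm_op_exp_apply_le (hA : IsSelfAdjoint A)
    (hβ : ∀ i, op A (β i) = (ε i : ℂ) • β i) {e s : ℝ} (hs : 0 ≤ s)
    {v : EuclideanSpace ℂ n} (h : ∀ i, e < ε i → inner ℂ (β i) v = 0) :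
    ‖op (NormedSpace.exp (s • A)) v‖ ≤ Real.exp (s * e) * ‖v‖ := by
  have hsa : IsSelfAdjoint (NormedSpace.exp (s • A)) := by
    rw [exp_smul_eq_cfc hA]
    exact cfc_predicate _ A
  have hexp : ∀ i, op (NormedSpace.exp (s • A)) (β i) = ((Real.exp (s * ε i) : ℝ) : ℂ) • β i :=
    fun i => op_exp_apply_eigenvector (hβ i) s
  refine le_of_sq_le_sq ?_ (by positivity)
  rw [mul_pow, ← β.sum_sq_norm_inner_right v, ← β.sum_sq_norm_inner_right, Finset.mul_sum]
  refine Finset.sum_le_sum fun i _ => ?_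
  rw [inner_eigenvector_op hsa hexp, norm_mul, mul_pow, Complex.norm_real,
    Real.norm_of_nonneg (Real.exp_pos _).le]
  by_cases hi : e < ε i
  · simp [h i hi]
  · have := not_lt.mp hi
    gcongr

omit [DecidableEq n] in
/-- Dimension count behind the min-max principle: some unit vector in the span of
`β' k`, `k ≤ j`, is mapped by `T` into the orthogonal complement of all `β k` with `k < j`. -/
theorem exists_norm_eq_one_inner_eq_zero [LinearOrder ι]
    (β β' : OrthonormalBasis ι ℂ (EuclideanSpace ℂ n))
    (T : EuclideanSpace ℂ n →L[ℂ] EuclideanSpace ℂ n) (j : ι) :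
    ∃ φ : EuclideanSpace ℂ n, ‖φ‖ = 1 ∧ (∀ k, j < k → inner ℂ (β' k) φ = 0) ∧
      ∀ k, k < j → inner ℂ (β k) (T φ) = 0 := by
  classical
  let S : ({k // k ≤ j} → ℂ) →ₗ[ℂ] EuclideanSpace ℂ n :=
    Fintype.linearCombination ℂ (fun k : {k // k ≤ j} => β' k)
  let F : ({k // k ≤ j} → ℂ) →ₗ[ℂ] ({k // k < j} → ℂ) :=
    LinearMap.pi fun k => (innerSL ℂ (β k)).toLinearMap ∘ₗ T.toLinearMap ∘ₗ S
  have hcard : Module.finrank ℂ ({k // k < j} → ℂ) < Module.finrank ℂ ({k // k ≤ j} → ℂ) := by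
    rw [Module.finrank_fintype_fun_eq_card, Module.finrank_fintype_fun_eq_card]
    exact Fintype.card_lt_of_injective_of_notMem (fun k => ⟨k.1, k.2.le⟩)
      (fun x y h => Subtype.ext (congrArg (fun z => z.1) h)) (b := ⟨j, le_rfl⟩)
      (by rintro ⟨k, hk⟩; exact k.2.ne (congrArg Subtype.val hk))
  obtain ⟨c, hc, hc0⟩ := Submodule.exists_mem_ne_zero_of_ne_bot
    (LinearMap.ker_ne_bot_of_finrank_lt (f := F) hcard)
  have hlin : LinearIndependent ℂ (fun k : {k // k ≤ j} => β' k) :=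
    β'.orthonormal.linearIndependent.comp _ Subtype.val_injective
  have hS : S c ≠ 0 := fun h => hc0 (funext fun k =>
    Fintype.linearIndependent_iff.mp hlin c
      (by simpa [S, Fintype.linearCombination_apply] using h) k)
  have hn : ‖S c‖ ≠ 0 := norm_ne_zero_iff.mpr hS
  refine ⟨((‖S c‖⁻¹ : ℝ) : ℂ) • S c, ?_, ?_, ?_⟩
  · rw [norm_smul, Complex.norm_real, norm_inv, norm_norm, inv_mul_cancel₀ hn]
  · intro k hk
    have h0 : inner ℂ (β' k) (S c) = 0 := by
      rw [Fintype.linearCombination_apply, inner_sum]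
      refine Finset.sum_eq_zero fun i _ => ?_
      rw [inner_smul_right,
        β'.inner_eq_zero (fun h => absurd i.2 (by rw [← h]; exact not_le.mpr hk)), mul_zero]
    rw [inner_smul_right, h0, mul_zero]
  · intro k hk
    have := congrFun (LinearMap.mem_ker.mp hc) ⟨k, hk⟩
    rw [map_smul, inner_smul_right]
    simp only [F, LinearMap.pi_apply, LinearMap.comp_apply, ContinuousLinearMap.coe_coe,
      innerSL_apply_apply, Pi.zero_apply] at this
    rw [this, mul_zero]

/-- A vector with small energy has small weight off the ground state `β i₀` if all other energies
are at least `Δ`. -/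
theorem sq_mul_weight_le (hA : IsSelfAdjoint A) (hβ : ∀ i, op A (β i) = (ε i : ℂ) • β i) {i₀ : ι}
    {Δ : ℝ} (hΔ : 0 ≤ Δ) (hgap : ∀ i, i ≠ i₀ → Δ ≤ ε i) (v : EuclideanSpace ℂ n) :
    Δ ^ 2 * (‖v‖ ^ 2 - ‖inner ℂ (β i₀) v‖ ^ 2) ≤ ‖op A v‖ ^ 2 := by
  classical
  rw [← β.sum_sq_norm_inner_right v, ← β.sum_sq_norm_inner_right,
    ← Finset.add_sum_erase _ _ (Finset.mem_univ i₀), add_sub_cancel_left, Finset.mul_sum,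
    ← Finset.add_sum_erase _ _ (Finset.mem_univ i₀)]
  refine (Finset.sum_le_sum fun i hi => ?_).trans (le_add_of_nonneg_left (sq_nonneg _))
  rw [inner_eigenvector_op hA hβ, norm_mul, mul_pow, Complex.norm_real, Real.norm_eq_abs, sq_abs]
  have := hgap i (Finset.ne_of_mem_erase hi)
  gcongr

end Eigenbasis

/-! ### Comparison of a Hamiltonian with its energy truncation -/

section Truncation

variable {n ι : Type*} [Fintype n] [DecidableEq n] [Fintype ι] {a K : Matrix n n ℂ} {b M l : ℝ}
  {β' : OrthonormalBasis ι ℂ (EuclideanSpace ℂ n)} {ε' : ι → ℝ}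

theorem isSelfAdjoint_cutoff (M : ℝ) (K : Matrix n n ℂ) : IsSelfAdjoint (cutoff M K) :=
  cfc_predicate _ K

/-- Low-energy vectors of the truncated Hamiltonian `a + min(K, M)` have exponentially small weight
on the bulk energies above the cutoff. -/
theorem norm_highProj_apply_le (hK : IsSelfAdjoint K) (ha : IsSelfAdjoint a) (hab : ‖a‖ ≤ b)
    (hl : 0 ≤ l)
    (hconj : ∀ t, 0 ≤ t → t ≤ l →
      ‖NormedSpace.exp (t • K) * a * NormedSpace.exp (-(t • K))‖ ≤ 2 * b)
    (hβ : ∀ i, op (a + cutoff M K) (β' i) = (ε' i : ℂ) • β' i) {e : ℝ}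
    {φ : EuclideanSpace ℂ n} (hφ : ∀ i, e < ε' i → inner ℂ (β' i) φ = 0) :
    ‖op (highProj M K) φ‖ ≤ Real.exp (-l * (M - e - 3 * b)) * ‖φ‖ := by
  have hG : IsSelfAdjoint (cutoff M K) := isSelfAdjoint_cutoff M K
  have hU := norm_exp_mul_exp_neg_add_le (a := a) (G := cutoff M K) hl
    (fun t h0 h1 => norm_exp_cutoff_conj_le hK (M := M) h0 hab (hconj t h0 h1))
  have hE := norm_op_exp_apply_le (ha.add hG) hβ hl hφ
  have hQ : highProj M K * NormedSpace.exp (-(l • cutoff M K)) =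
      Real.exp (-l * M) • highProj M K := by
    rw [← neg_smul, cutoff, exp_smul_cfc hK, highProj, specProj, cfc_matrix_mul,
      ← cfc_const_mul _ _ K (K.finite_real_spectrum.continuousOn _)]
    congr 1
    ext x
    by_cases h : M ≤ x <;> simp [h]
  have hfac : highProj M K = highProj M K * NormedSpace.exp (-(l • cutoff M K)) *
      (NormedSpace.exp (l • cutoff M K) * NormedSpace.exp (-(l • (a + cutoff M K)))) *
        NormedSpace.exp (l • (a + cutoff M K)) := by
    have h1 := exp_neg_mul_exp (l • cutoff M K)
    have h2 := exp_neg_mul_exp (l • (a + cutoff M K))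
    rw [mul_assoc, mul_assoc _ _ (NormedSpace.exp (l • (a + cutoff M K))), h2, mul_one, mul_assoc,
      h1, mul_one]
  have hnQ := norm_specProj_le K (Set.Ici M)
  rw [hfac, hQ, op_mul_apply]
  refine (norm_op_apply_le _ _).trans ?_
  have hmat : ‖Real.exp (-l * M) • highProj M K *
      (NormedSpace.exp (l • cutoff M K) * NormedSpace.exp (-(l • (a + cutoff M K))))‖ ≤
      Real.exp (-l * M) * 1 * Real.exp (3 * b * l) := by
    refine (norm_mul_le _ _).trans (mul_le_mul ?_ hU (norm_nonneg _) (by positivity))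
    rw [norm_smul, Real.norm_of_nonneg (Real.exp_pos _).le]
    gcongr
    exact hnQ
  calc _ ≤ Real.exp (-l * M) * 1 * Real.exp (3 * b * l) * (Real.exp (l * e) * ‖φ‖) :=
        mul_le_mul hmat hE (norm_nonneg _) (by positivity)
    _ = Real.exp (-l * (M - e - 3 * b)) * ‖φ‖ := by
        rw [mul_one, ← mul_assoc, ← Real.exp_add, ← Real.exp_add]
        congr 2
        ring

theorem cutoff_mul_lowProj (hK : IsSelfAdjoint K) (M : ℝ) :
    cutoff M K * lowProj M K = K * lowProj M K := by
  have h : K * lowProj M K = cfc (fun x : ℝ => x) K * lowProj M K := by rw [cfc_id' ℝ K hK]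
  rw [h, cutoff, lowProj, specProj, cfc_matrix_mul, cfc_matrix_mul]
  congr 1
  ext x
  by_cases hx : x < M
  · simp [hx, hx.le]
  · simp [hx]

theorem cutoff_mul_highProj (K : Matrix n n ℂ) (M : ℝ) :
    cutoff M K * highProj M K = M • highProj M K := by
  rw [cutoff, highProj, specProj, cfc_matrix_mul,
    ← cfc_const_mul _ _ K (K.finite_real_spectrum.continuousOn _)]
  congr 1
  ext x
  by_cases hx : M ≤ x <;> simp [hx]

theorem lowProj_mul_highProj (K : Matrix n n ℂ) (M : ℝ) : lowProj M K * highProj M K = 0 := by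
  rw [lowProj, highProj, specProj, specProj, cfc_matrix_mul, ← cfc_zero ℝ K]
  congr 1
  ext x
  by_cases hx : M ≤ x
  · simp [hx]
  · simp [hx]

theorem inner_lowProj_highProj (K : Matrix n n ℂ) (M : ℝ) (φ : EuclideanSpace ℂ n) :
    inner ℂ (op (lowProj M K) φ) (op (highProj M K) φ) = 0 := by
  have h : IsSelfAdjoint (lowProj M K) := cfc_predicate _ K
  rw [inner_op_left h, ← op_mul_apply, lowProj_mul_highProj]
  simp

/-- Removing the energies above the cutoff from `φ` turns the truncated Hamiltonian into the
original one and raises the energy by at most `2b ‖φ‖ ‖Qφ‖`: the bulk part is block diagonal, and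
on the removed block it is `M ≥ ‖a‖`. -/
theorem re_inner_lowProj_le (hK : IsSelfAdjoint K) (hab : ‖a‖ ≤ b)
    (hbM : b ≤ M) (φ : EuclideanSpace ℂ n) :
    (inner ℂ (op (lowProj M K) φ) (op (a + K) (op (lowProj M K) φ))).re ≤
      (inner ℂ φ (op (a + cutoff M K) φ)).re + 2 * b * (‖φ‖ * ‖op (highProj M K) φ‖) := by
  have hb : 0 ≤ b := (norm_nonneg a).trans hab
  set p := op (lowProj M K) φ with hp
  set q := op (highProj M K) φ with hq
  have hφ : φ = p + q := by
    rw [hp, hq, ← op_add_apply, lowProj_add_highProj hK, op_one_apply]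
  have hKp : op K p = op (cutoff M K) p := by
    rw [hp, ← op_mul_apply, ← op_mul_apply, cutoff_mul_lowProj hK]
  have hKq : op (cutoff M K) q = (M : ℂ) • q := by
    rw [hq, ← op_mul_apply, cutoff_mul_highProj, op_real_smul_apply]
  have hpq : inner ℂ p q = 0 := inner_lowProj_highProj K M φ
  have hqp : inner ℂ q p = 0 := by rw [← inner_conj_symm, hpq, map_zero]
  have hGqp : inner ℂ q (op (cutoff M K) p) = 0 := by
    rw [← inner_op_left (isSelfAdjoint_cutoff M K), hKq, inner_smul_left, hqp, mul_zero]
  have hnp : ‖p‖ ≤ ‖φ‖ := by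
    refine (norm_op_apply_le _ _).trans ?_
    exact mul_le_of_le_one_left (norm_nonneg _) (norm_specProj_le K _)
  have hexpand : (inner ℂ φ (op (a + cutoff M K) φ)).re =
      (inner ℂ p (op (a + K) p)).re + (inner ℂ p (op a q)).re + (inner ℂ q (op a p)).re +
        (inner ℂ q (op a q)).re + M * ‖q‖ ^ 2 := by
    have hqq : (inner ℂ q q).re = ‖q‖ ^ 2 := inner_self_eq_norm_sq (𝕜 := ℂ) q
    rw [hφ, op_add_apply, map_add, map_add, op_add_apply a K, hKp, hKq]
    simp only [inner_add_left, inner_add_right, inner_smul_right, hpq, hGqp, add_zero,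
      Complex.add_re, Complex.zero_re, Complex.re_ofReal_mul, hqq]
    ring
  have hbound : ∀ u v : EuclideanSpace ℂ n, -(b * (‖u‖ * ‖v‖)) ≤ (inner ℂ u (op a v)).re := by
    intro u v
    have h1 := (Complex.abs_re_le_norm (inner ℂ u (op a v))).trans (norm_inner_le_norm _ _)
    have h2 := (norm_op_apply_le a v).trans (mul_le_mul_of_nonneg_right hab (norm_nonneg v))
    have h3 := neg_le_of_abs_le (h1.trans (mul_le_mul_of_nonneg_left h2 (norm_nonneg u)))
    linarith
  have h1 := hbound p q
  have h2 := hbound q p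
  have h3 := hbound q q
  have h4 : b * (‖p‖ * ‖q‖) ≤ b * (‖φ‖ * ‖q‖) := by gcongr
  have h5 : b * (‖q‖ * ‖q‖) ≤ M * ‖q‖ ^ 2 := by
    rw [sq]
    gcongr
  rw [hexpand]
  linarith [mul_comm ‖p‖ ‖q‖, h2, congrArg (b * ·) (mul_comm ‖p‖ ‖q‖)]

variable [LinearOrder ι] {β : OrthonormalBasis ι ℂ (EuclideanSpace ℂ n)} {ε : ι → ℝ}

/-- Truncation lowers the Hamiltonian, hence each eigenvalue in increasing order. -/
theorem truncated_eigenvalue_le (hK : IsSelfAdjoint K) (ha : IsSelfAdjoint a)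
    (hε : Monotone ε) (hβ : ∀ i, op (a + K) (β i) = (ε i : ℂ) • β i)
    (hε' : Monotone ε') (hβ' : ∀ i, op (a + cutoff M K) (β' i) = (ε' i : ℂ) • β' i) (j : ι) :
    ε' j ≤ ε j := by
  have hG : IsSelfAdjoint (cutoff M K) := isSelfAdjoint_cutoff M K
  obtain ⟨φ, hφ, h1, h2⟩ := exists_norm_eq_one_inner_eq_zero β' β (ContinuousLinearMap.id ℂ _) j
  have hlow := le_re_inner_op (ha.add hG) hβ' (e := ε' j) (v := φ)
    (fun i hi => h2 i (hε'.reflect_lt hi))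
  have hup := re_inner_op_le (ha.add hK) hβ (e := ε j) (v := φ)
    (fun i hi => h1 i (hε.reflect_lt hi))
  have hdiff : K = cutoff M K + cfc (fun x => x - min x M) K := by
    conv_lhs => rw [← cfc_id' ℝ K hK]
    rw [cutoff, ← cfc_add _ _ _ (K.finite_real_spectrum.continuousOn _)
      (K.finite_real_spectrum.continuousOn _)]
    congr 1
    ext x
    ring
  have hpos := re_inner_op_cfc_nonneg K (f := fun x => x - min x M)
    (fun x => sub_nonneg.mpr (min_le_left x M)) φ
  have hcmp : (inner ℂ φ (op (a + K) φ)).re = (inner ℂ φ (op (a + cutoff M K) φ)).re +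
      (inner ℂ φ (op (cfc (fun x => x - min x M) K) φ)).re := by
    conv_lhs => rw [hdiff]
    rw [← add_assoc, op_add_apply, inner_add_right, Complex.add_re]
  rw [hφ, one_pow, mul_one] at hlow hup
  linarith

/-- The trial space is the image, under the projection below the cutoff, of the span of the
eigenvectors of the truncated Hamiltonian up to level `j`. -/
theorem eigenvalue_sub_le_truncated (hK : IsSelfAdjoint K) (ha : IsSelfAdjoint a) (hab : ‖a‖ ≤ b)
    (hbM : b ≤ M) (hl : 0 ≤ l)
    (hconj : ∀ t, 0 ≤ t → t ≤ l →
      ‖NormedSpace.exp (t • K) * a * NormedSpace.exp (-(t • K))‖ ≤ 2 * b)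
    (hε : Monotone ε) (hβ : ∀ i, op (a + K) (β i) = (ε i : ℂ) • β i)
    (hε' : Monotone ε') (hβ' : ∀ i, op (a + cutoff M K) (β' i) = (ε' i : ℂ) • β' i) {j : ι}
    (hpos : 0 ≤ ε j) :
    ε j - (ε j + 2 * b) * Real.exp (-l * (M - ε' j - 3 * b)) ≤ ε' j := by
  have hb : 0 ≤ b := (norm_nonneg a).trans hab
  have hG : IsSelfAdjoint (cutoff M K) := isSelfAdjoint_cutoff M K
  obtain ⟨φ, hφ, h1, h2⟩ := exists_norm_eq_one_inner_eq_zero β β' (op (lowProj M K)) j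
  have h1' : ∀ i, ε' j < ε' i → inner ℂ (β' i) φ = 0 := fun i hi => h1 i (hε'.reflect_lt hi)
  have hlow := le_re_inner_op (ha.add hK) hβ (e := ε j) (v := op (lowProj M K) φ)
    (fun i hi => h2 i (hε.reflect_lt hi))
  have hup := re_inner_op_le (ha.add hG) hβ' h1'
  have hq := norm_highProj_apply_le hK ha hab hl hconj hβ' h1'
  have hmid := re_inner_lowProj_le hK hab hbM φ
  have hpyth : ‖op (lowProj M K) φ‖ ^ 2 + ‖op (highProj M K) φ‖ ^ 2 = 1 := by
    have hpq : inner ℂ (op (lowProj M K) φ) (op (highProj M K) φ) = 0 :=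
      inner_lowProj_highProj K M φ
    have := norm_add_sq_eq_norm_sq_add_norm_sq_of_inner_eq_zero _ _ hpq
    rw [← op_add_apply, lowProj_add_highProj hK, op_one_apply, hφ] at this
    linarith
  rw [hφ] at hup hq hmid
  set q := ‖op (highProj M K) φ‖ with hqdef
  have hq0 : 0 ≤ q := norm_nonneg _
  have hq1 : q ≤ 1 := by nlinarith [sq_nonneg ‖op (lowProj M K) φ‖]
  have hqq : ε j * q ^ 2 ≤ ε j * q := by
    gcongr
    nlinarith
  have hlow' : ε j * ‖op (lowProj M K) φ‖ ^ 2 = ε j - ε j * q ^ 2 := by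
    rw [eq_sub_of_add_eq hpyth]
    ring
  have hfin : (ε j + 2 * b) * q ≤ (ε j + 2 * b) * Real.exp (-l * (M - ε' j - 3 * b)) :=
    mul_le_mul_of_nonneg_left (by simpa using hq) (by positivity)
  linarith

omit [LinearOrder ι] in
/-- Overlap of the ground state `β i₀` with an eigenvector `φ` of the truncated Hamiltonian. The
part `Pφ` of `φ` below the cutoff satisfies `H Pφ = e φ - (a + M) Qφ`. -/
theorem one_sub_sq_le_overlap (hK : IsSelfAdjoint K) (ha : IsSelfAdjoint a) (hab : ‖a‖ ≤ b)
    (hM : 0 ≤ M) (hβ : ∀ i, op (a + K) (β i) = (ε i : ℂ) • β i) {i₀ : ι} {Δ : ℝ} (hΔ : 0 < Δ)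
    (hgap : ∀ i, i ≠ i₀ → Δ ≤ ε i) {φ : EuclideanSpace ℂ n} {e q d : ℝ} (hφ : ‖φ‖ = 1)
    (heig : op (a + cutoff M K) φ = (e : ℂ) • φ) (he : |e| ≤ d)
    (hq : ‖op (highProj M K) φ‖ ≤ q) :
    1 - ((d + (M + b + Δ) * q) / Δ) ^ 2 ≤ ‖inner ℂ (β i₀) φ‖ ^ 2 := by
  have hb : 0 ≤ b := (norm_nonneg a).trans hab
  -- `R v` is the component of `v` orthogonal to the ground state.
  let R : EuclideanSpace ℂ n → EuclideanSpace ℂ n := fun v => v - inner ℂ (β i₀) v • β i₀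
  have hR : ∀ v, ‖R v‖ ^ 2 = ‖v‖ ^ 2 - ‖inner ℂ (β i₀) v‖ ^ 2 := by
    intro v
    have horth : inner ℂ (R v) (inner ℂ (β i₀) v • β i₀) = 0 := by
      have h1 : inner ℂ (β i₀) (β i₀) = (1 : ℂ) := by
        rw [inner_self_eq_norm_sq_to_K, β.orthonormal.1 i₀]
        simp
      rw [inner_smul_right, inner_sub_left, inner_smul_left, h1, inner_conj_symm]
      simp
    have := norm_add_sq_eq_norm_sq_add_norm_sq_of_inner_eq_zero _ _ horth
    rw [sub_add_cancel, norm_smul, β.orthonormal.1 i₀, mul_one] at this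
    linarith
  have hRle : ∀ v, ‖R v‖ ≤ ‖v‖ := fun v =>
    le_of_sq_le_sq (by rw [hR]; linarith [sq_nonneg ‖inner ℂ (β i₀) v‖]) (norm_nonneg _)
  set p := op (lowProj M K) φ with hp
  set w := op (highProj M K) φ with hw
  have hsum : p + w = φ := by
    rw [hp, hw, ← op_add_apply, lowProj_add_highProj hK, op_one_apply]
  have hHp : op (a + K) p = (e : ℂ) • φ - (op a w + (M : ℂ) • w) := by
    have hKw : op (cutoff M K) w = (M : ℂ) • w := by
      rw [hw, ← op_mul_apply, cutoff_mul_highProj, op_real_smul_apply]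
    have hKp : op K p = op (cutoff M K) p := by
      rw [hp, ← op_mul_apply, ← op_mul_apply, cutoff_mul_lowProj hK]
    rw [op_add_apply, hKp, ← op_add_apply, eq_sub_of_add_eq hsum, map_sub, heig,
      op_add_apply a _ w, hKw]
  have hHpn : ‖op (a + K) p‖ ≤ d + (M + b) * q := by
    rw [hHp]
    refine (norm_sub_le _ _).trans (add_le_add ?_ ((norm_add_le _ _).trans ?_))
    · rw [norm_smul, hφ, mul_one, Complex.norm_real]
      exact he
    · rw [norm_smul, Complex.norm_real, Real.norm_of_nonneg hM]
      have h1 := norm_op_apply_le a w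
      have h2 : ‖a‖ * ‖w‖ ≤ b * q := by gcongr
      have h3 : M * ‖w‖ ≤ M * q := by gcongr
      linarith
  have hRp : Δ * ‖R p‖ ≤ d + (M + b) * q := by
    refine le_trans (le_of_sq_le_sq ?_ (norm_nonneg _)) hHpn
    rw [mul_pow, hR]
    exact sq_mul_weight_le (ha.add hK) hβ hΔ.le hgap p
  have hRφ : ‖R φ‖ ≤ (d + (M + b + Δ) * q) / Δ := by
    rw [le_div_iff₀ hΔ]
    have h1 : R φ = R p + R w := by
      simp only [R, ← hsum, inner_add_right, add_smul]
      abel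
    have h2 : ‖R φ‖ ≤ ‖R p‖ + ‖w‖ := by
      rw [h1]
      exact (norm_add_le _ _).trans (add_le_add_right (hRle w) _)
    nlinarith
  have hfin := pow_le_pow_left₀ (norm_nonneg _) hRφ 2
  rw [hR, hφ] at hfin
  linarith

/-- If the spectrum lies above `-M`, the energy truncation is the function `min(x, M)` of `K`. -/
theorem energyTruncation_eq_cutoff (hK : IsSelfAdjoint K) (h : ∀ x ∈ spectrum ℝ K, -M < x) :
    energyTruncation M K = cutoff M K := by
  have hK' : K * specProj K (Set.Ioo (-M) M) =
      cfc (fun x : ℝ => x) K * specProj K (Set.Ioo (-M) M) := by rw [cfc_id' ℝ K hK]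
  rw [energyTruncation, hK', cutoff, specProj, specProj, cfc_matrix_mul, Complex.coe_smul,
    ← cfc_const_mul _ _ K (K.finite_real_spectrum.continuousOn _),
    ← cfc_add _ _ _ (K.finite_real_spectrum.continuousOn _)
      (K.finite_real_spectrum.continuousOn _)]
  refine cfc_congr fun x hx => ?_
  have hx' := h x hx
  by_cases hxM : x < M
  · simp [hx', hxM, hxM.le]
  · simp [hxM, not_lt.mp hxM]

/-- A boundary term of norm less than `M` cannot push the bulk spectrum below `-M` if the total
Hamiltonian is nonnegative. -/
theorem neg_lt_of_mem_spectrum (hK : IsSelfAdjoint K) (hab : ‖a‖ < M)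
    (hpos : ∀ v, 0 ≤ (inner ℂ v (op (a + K) v)).re) {x : ℝ} (hx : x ∈ spectrum ℝ K) : -M < x := by
  have hK' : K.IsHermitian := hK
  rw [hK'.spectrum_real_eq_range_eigenvalues] at hx
  obtain ⟨i, rfl⟩ := hx
  set v := hK'.eigenvectorBasis i with hv
  have hv1 : ‖v‖ = 1 := hK'.eigenvectorBasis.orthonormal.1 i
  have hKv : op K v = (hK'.eigenvalues i : ℂ) • v := by
    have h := hK'.mulVec_eigenvectorBasis i
    ext k
    simpa using congrFun h k
  have h1 := hpos v
  have hvv : inner ℂ v v = (1 : ℂ) := by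
    rw [inner_self_eq_norm_sq_to_K, hv1]
    simp
  rw [op_add_apply, inner_add_right, hKv, inner_smul_right, hvv, mul_one, Complex.add_re,
    Complex.ofReal_re] at h1
  have h2 := (Complex.re_le_norm (inner ℂ v (op a v))).trans (norm_inner_le_norm _ _)
  have h3 := norm_op_apply_le a v
  rw [hv1] at h2 h3
  linarith

end Truncation

/-! ### Local observables and the growth of iterated commutators -/

section Embed

variable {V : Type*} [DecidableEq V] {d : ℕ} {X Z Λ : Finset V}

/-- Splitting a configuration on `Λ` into its parts inside and outside `X`. -/
def configSplit (d : ℕ) (h : X ⊆ Λ) :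
    Config d Λ ≃ Config d X × ({z : Λ // z.1 ∉ X} → Fin d) where
  toFun σ := (fun z => σ ⟨z.1, h z.2⟩, fun z => σ z.1)
  invFun p := fun z => if hz : z.1 ∈ X then p.1 ⟨z.1, hz⟩ else p.2 ⟨z, hz⟩
  left_inv σ := by
    ext z
    by_cases hz : z.1 ∈ X <;> simp [hz]
  right_inv p := by
    ext z
    · simp
    · simp [z.2]

open scoped Kronecker in
theorem embed_eq_submatrix_kronecker (h : X ⊆ Λ) (A : Obs d X) :
    embed h A = (A ⊗ₖ (1 : Matrix ({z : Λ // z.1 ∉ X} → Fin d) _ ℂ)).submatrix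
      (configSplit d h) (configSplit d h) := by
  ext σ τ
  simp [embed, configSplit, Matrix.kroneckerMap_apply, Matrix.one_apply, funext_iff]

theorem embed_add (h : X ⊆ Λ) (A C : Obs d X) : embed h (A + C) = embed h A + embed h C := by
  ext σ τ
  simp only [embed, Matrix.of_apply, Matrix.add_apply]
  split_ifs <;> simp

theorem embed_smul (h : X ⊆ Λ) (c : ℂ) (A : Obs d X) : embed h (c • A) = c • embed h A := by
  ext σ τ
  simp only [embed, Matrix.of_apply, Matrix.smul_apply]
  split_ifs <;> simp

theorem embed_zero (h : X ⊆ Λ) : embed h (0 : Obs d X) = 0 := by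
  simpa using embed_smul h 0 (0 : Obs d X)

theorem embed_mul (h : X ⊆ Λ) (A C : Obs d X) : embed h (A * C) = embed h A * embed h C := by
  rw [embed_eq_submatrix_kronecker, embed_eq_submatrix_kronecker, embed_eq_submatrix_kronecker,
    Matrix.submatrix_mul_equiv, ← Matrix.mul_kronecker_mul, one_mul]

theorem embed_conjTranspose (h : X ⊆ Λ) (A : Obs d X) :
    embed h A.conjTranspose = (embed h A).conjTranspose := by
  ext σ τ
  simp only [embed, Matrix.of_apply, Matrix.conjTranspose_apply]
  by_cases hc : ∀ z : Λ, z.1 ∉ X → σ z = τ z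
  · rw [if_pos hc, if_pos fun z hz => (hc z hz).symm]
  · rw [if_neg hc, if_neg fun h' => hc fun z hz => (h' z hz).symm, star_zero]

/-- The inclusion `𝒜_X ⊆ 𝒜_Λ` as a homomorphism of star algebras. -/
def embedHom (h : X ⊆ Λ) : Obs d X →⋆ₙₐ[ℂ] Obs d Λ where
  toFun := embed h
  map_smul' := embed_smul h
  map_zero' := embed_zero h
  map_add' := embed_add h
  map_mul' := embed_mul h
  map_star' := embed_conjTranspose h

/-- Homomorphisms of C⋆-algebras are contractive. -/
theorem norm_embed_le (h : X ⊆ Λ) (A : Obs d X) : ‖embed h A‖ ≤ ‖A‖ :=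
  NonUnitalStarAlgHom.norm_apply_le (embedHom h) A

theorem embed_embed {Y : Finset V} (hXY : X ⊆ Y) (hY : Y ⊆ Λ) (A : Obs d X) :
    embed hY (embed hXY A) = embed (hXY.trans hY) A := by
  ext σ τ
  simp only [embed, Matrix.of_apply]
  have hiff : (∀ z : Λ, z.1 ∉ X → σ z = τ z) ↔ (∀ z : Λ, z.1 ∉ Y → σ z = τ z) ∧
      ∀ z : Y, z.1 ∉ X → σ ⟨z.1, hY z.2⟩ = τ ⟨z.1, hY z.2⟩ := by
    refine ⟨fun hc => ⟨fun z hz => hc z fun hX => hz (hXY hX), fun z hz => hc _ hz⟩,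
      fun h z hz => ?_⟩
    by_cases hzY : z.1 ∈ Y
    · exact h.2 ⟨z.1, hzY⟩ hz
    · exact h.1 z hzY
  simp only [hiff, ite_and]

/-- The product of observables with disjoint supports has the entries of their tensor product; the
expression is symmetric, so the two factors commute. -/
theorem embed_mul_embed_apply (hX : X ⊆ Λ) (hZ : Z ⊆ Λ) (hd : Disjoint X Z) (A : Obs d X)
    (C : Obs d Z) (σ τ : Config d Λ) :
    (embed hX A * embed hZ C) σ τ =
      if ∀ z : Λ, z.1 ∉ X → z.1 ∉ Z → σ z = τ z then
        A (fun z => σ ⟨z.1, hX z.2⟩) (fun z => τ ⟨z.1, hX z.2⟩) *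
          C (fun z => σ ⟨z.1, hZ z.2⟩) (fun z => τ ⟨z.1, hZ z.2⟩)
      else 0 := by
  have hXZ : ∀ z, z ∈ X → z ∉ Z := fun z h1 h2 => Finset.disjoint_left.mp hd h1 h2
  rw [Matrix.mul_apply]
  -- The only intermediate configuration that contributes is `τ` on `X` and `σ` off `X`.
  set ρ : Config d Λ := fun z => if z.1 ∈ X then τ z else σ z with hρ
  rw [Finset.sum_eq_single ρ]
  · have h1 : ∀ z : Λ, z.1 ∉ X → σ z = ρ z := fun z hz => by simp [hρ, hz]
    have h2 : (fun z : X => ρ ⟨z.1, hX z.2⟩) = fun z : X => τ ⟨z.1, hX z.2⟩ := by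
      ext z
      simp [hρ]
    have h3 : (fun z : Z => ρ ⟨z.1, hZ z.2⟩) = fun z : Z => σ ⟨z.1, hZ z.2⟩ := by
      ext z
      have : z.1 ∉ X := fun h => hXZ _ h z.2
      simp [hρ, this]
    simp only [embed, Matrix.of_apply]
    rw [if_pos h1, h2, h3]
    by_cases hc : ∀ z : Λ, z.1 ∉ X → z.1 ∉ Z → σ z = τ z
    · rw [if_pos hc, if_pos]
      intro z hz
      by_cases hzX : z.1 ∈ X
      · simp [hρ, hzX]
      · simpa [hρ, hzX] using hc z hzX hz
    · rw [if_neg hc, if_neg, mul_zero]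
      intro h
      refine hc fun z hzX hz => ?_
      simpa [hρ, hzX] using h z hz
  · intro κ _ hκ
    simp only [embed, Matrix.of_apply]
    split_ifs with h1 h2
    · refine absurd (funext fun z => ?_) hκ
      by_cases hzX : z.1 ∈ X
      · simp [hρ, hzX, h2 z (hXZ _ hzX)]
      · simp [hρ, hzX, h1 z hzX]
    · rw [mul_zero]
    · rw [zero_mul]
    · rw [zero_mul]
  · simp

theorem commute_embed_of_disjoint (hX : X ⊆ Λ) (hZ : Z ⊆ Λ) (hd : Disjoint X Z) (A : Obs d X)
    (C : Obs d Z) : Commute (embed hX A) (embed hZ C) := by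
  ext σ τ
  rw [embed_mul_embed_apply hX hZ hd, embed_mul_embed_apply hZ hX hd.symm]
  simp only [mul_comm]
  congr 1
  exact propext (forall_congr' fun z => ⟨fun h h1 h2 => h h2 h1, fun h h1 h2 => h h2 h1⟩)

/-- `A ∈ 𝒜_Λ` is supported on `X` if it commutes with every observable localized in a subset of `Λ`
disjoint from `X`. Locality enters only through the vanishing of commutators, so the commutant is
more convenient here than membership in the image of `𝒜_X`. -/
def SupportedOn (X : Finset V) (A : Obs d Λ) : Prop :=
  ∀ (Z : Finset V) (h : Z ⊆ Λ), Disjoint X Z → ∀ C : Obs d Z, Commute A (embed h C)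

theorem supportedOn_embed (h : X ⊆ Λ) (A : Obs d X) : SupportedOn X (embed h A) :=
  fun _ hZ hd C => commute_embed_of_disjoint h hZ hd A C

theorem SupportedOn.commutator {A C : Obs d Λ} (hA : SupportedOn X A) (hC : SupportedOn Z C) :
    SupportedOn (X ∪ Z) (C * A - A * C) := by
  intro Y hY hd D
  have h1 := hA Y hY (hd.mono_left Finset.subset_union_left) D
  have h2 := hC Y hY (hd.mono_left Finset.subset_union_right) D
  exact (h2.mul_left h1).sub_left (h1.mul_left h2)

/-- Iterated commutators of a sum of local terms with a local observable. Only the terms meeting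
`X` contribute to the first commutator, and each of them enlarges the support by at most `N` sites,
so the `k`-th commutator costs a factor `2 J (|X| + k N)`. -/
theorem norm_adCLM_pow_apply_le (S : Finset (Finset V)) (T : (Z : Finset V) → Obs d Z) {J : ℝ}
    {N : ℕ} (hS : ∀ Z ∈ S, Z ⊆ Λ) (K : Obs d Λ)
    (hK : K = ∑ Z ∈ S.attach, embed (hS Z.1 Z.2) (T Z.1))
    (hcard : ∀ Z ∈ S, Z.Nonempty → T Z ≠ 0 → Z.card ≤ N)
    (hJ : ∀ x, ∑ Z ∈ S with x ∈ Z, ‖T Z‖ ≤ J) (hJ0 : 0 ≤ J) (m : ℕ) :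
    ∀ (X : Finset V) (A : Obs d Λ), SupportedOn X A →
      ‖(adCLM K ^ m) A‖ ≤ (∏ k ∈ Finset.range m, 2 * J * (X.card + k * N)) * ‖A‖ := by
  induction m with
  | zero =>
    intro X A _
    simp
  | succ m ih =>
    intro X A hA
    set P : ℝ := ∏ k ∈ Finset.range m, 2 * J * (X.card + (k + 1 : ℕ) * N) with hP
    have hP0 : 0 ≤ P := Finset.prod_nonneg fun k _ => by positivity
    have hterm : ∀ Z : {Z // Z ∈ S},
        ‖(adCLM K ^ m) (embed (hS Z.1 Z.2) (T Z.1) * A - A * embed (hS Z.1 Z.2) (T Z.1))‖ ≤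
          ∑ x ∈ X, if x ∈ Z.1 then ‖T Z.1‖ * (2 * P * ‖A‖) else 0 := by
      rintro ⟨Z, hZ⟩
      have hnn : ∀ x ∈ X, (0 : ℝ) ≤ if x ∈ Z then ‖T Z‖ * (2 * P * ‖A‖) else 0 := by
        intro x _
        split_ifs <;> positivity
      have hzero : embed (hS Z hZ) (T Z) * A - A * embed (hS Z hZ) (T Z) = 0 →
          ‖(adCLM K ^ m) (embed (hS Z hZ) (T Z) * A - A * embed (hS Z hZ) (T Z))‖ ≤
          ∑ x ∈ X, if x ∈ Z then ‖T Z‖ * (2 * P * ‖A‖) else 0 := by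
        intro h
        rw [h, map_zero, norm_zero]
        exact Finset.sum_nonneg hnn
      by_cases hd : Disjoint X Z
      · exact hzero (sub_eq_zero.mpr (hA Z (hS Z hZ) hd (T Z)).eq.symm)
      by_cases hT : T Z = 0
      · exact hzero (by rw [hT, embed_zero, zero_mul, mul_zero, sub_zero])
      obtain ⟨x, hxX, hxZ⟩ := Finset.not_disjoint_iff.mp hd
      have hN := hcard Z hZ ⟨x, hxZ⟩ hT
      have hcu : ((X ∪ Z).card : ℝ) ≤ X.card + N := by
        exact_mod_cast (Finset.card_union_le X Z).trans (Nat.add_le_add_left hN _)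
      have h1 := ih (X ∪ Z) _ (hA.commutator (supportedOn_embed (hS Z hZ) (T Z)))
      have h2 : (∏ k ∈ Finset.range m, 2 * J * ((X ∪ Z).card + k * N : ℝ)) ≤ P := by
        refine Finset.prod_le_prod (fun k _ => by positivity) fun k _ => ?_
        have : ((X ∪ Z).card + k * N : ℝ) ≤ X.card + (k + 1 : ℕ) * N := by
          push_cast
          linarith
        gcongr
      have h3 : ‖embed (hS Z hZ) (T Z) * A - A * embed (hS Z hZ) (T Z)‖ ≤ 2 * ‖T Z‖ * ‖A‖ := by
        have hle := norm_embed_le (hS Z hZ) (T Z)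
        have h4 := (norm_mul_le (embed (hS Z hZ) (T Z)) A).trans
          (mul_le_mul_of_nonneg_right hle (norm_nonneg A))
        have h5 := (norm_mul_le A (embed (hS Z hZ) (T Z))).trans
          (mul_le_mul_of_nonneg_left hle (norm_nonneg A))
        refine (norm_sub_le _ _).trans ?_
        linarith
      calc _ ≤ P * (2 * ‖T Z‖ * ‖A‖) := h1.trans (mul_le_mul h2 h3 (norm_nonneg _) hP0)
        _ = if x ∈ Z then ‖T Z‖ * (2 * P * ‖A‖) else 0 := by
          rw [if_pos hxZ]
          ring
        _ ≤ _ := Finset.single_le_sum hnn hxX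
    have hsum : (adCLM K ^ (m + 1)) A = ∑ Z ∈ S.attach,
        (adCLM K ^ m) (embed (hS Z.1 Z.2) (T Z.1) * A - A * embed (hS Z.1 Z.2) (T Z.1)) := by
      rw [pow_succ, mul_apply_eq_comp, adCLM_apply, ← map_sum, Finset.sum_sub_distrib, hK,
        Finset.sum_mul, Finset.mul_sum]
    rw [hsum]
    calc _ ≤ ∑ Z ∈ S.attach, ∑ x ∈ X, if x ∈ Z.1 then ‖T Z.1‖ * (2 * P * ‖A‖) else 0 :=
          norm_sum_le_of_le _ fun Z _ => hterm Z
      _ = ∑ x ∈ X, (∑ Z ∈ S with x ∈ Z, ‖T Z‖) * (2 * P * ‖A‖) := by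
          rw [Finset.sum_attach S
            (fun Z => ∑ x ∈ X, if x ∈ Z then ‖T Z‖ * (2 * P * ‖A‖) else 0), Finset.sum_comm]
          refine Finset.sum_congr rfl fun x _ => ?_
          rw [Finset.sum_mul, Finset.sum_filter]
      _ ≤ ∑ x ∈ X, J * (2 * P * ‖A‖) := by
          refine Finset.sum_le_sum fun x _ => ?_
          have := hJ x
          gcongr
      _ = _ := by
          rw [Finset.prod_range_succ', Finset.sum_const, nsmul_eq_mul, ← hP]
          push_cast
          ring

theorem norm_adCLM_pow_apply_le_factorial (S : Finset (Finset V)) (T : (Z : Finset V) → Obs d Z)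
    {J : ℝ} {N : ℕ} (hS : ∀ Z ∈ S, Z ⊆ Λ) (K : Obs d Λ)
    (hK : K = ∑ Z ∈ S.attach, embed (hS Z.1 Z.2) (T Z.1))
    (hcard : ∀ Z ∈ S, Z.Nonempty → T Z ≠ 0 → Z.card ≤ N)
    (hJ : ∀ x, ∑ Z ∈ S with x ∈ Z, ‖T Z‖ ≤ J) (hJ0 : 0 ≤ J) {A : Obs d Λ}
    (hA : SupportedOn X A) (m : ℕ) :
    ‖(adCLM K ^ m) A‖ ≤ m.factorial * (2 * J * (N + X.card)) ^ m * ‖A‖ := by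
  refine (norm_adCLM_pow_apply_le S T hS K hK hcard hJ hJ0 m X A hA).trans ?_
  gcongr
  have : (m.factorial * (2 * J * (N + X.card)) ^ m : ℝ) =
      ∏ k ∈ Finset.range m, ((k + 1 : ℕ) : ℝ) * (2 * J * (N + X.card)) := by
    rw [Finset.prod_mul_distrib, Finset.prod_const, Finset.card_range,
      ← Finset.prod_range_add_one_eq_factorial, Nat.cast_prod]
  rw [this]
  refine Finset.prod_le_prod (fun k _ => by positivity) fun k _ => ?_
  have h : (X.card + k * N : ℝ) ≤ ((k + 1 : ℕ) : ℝ) * (N + X.card) := by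
    push_cast
    nlinarith [mul_nonneg (Nat.cast_nonneg (α := ℝ) k) (Nat.cast_nonneg (α := ℝ) X.card),
      Nat.cast_nonneg (α := ℝ) N]
  calc _ ≤ 2 * J * (((k + 1 : ℕ) : ℝ) * (N + X.card)) := by gcongr
    _ = _ := by ring

end Embed

/-! ### Finite range and the interaction boundary -/

section Lattice

variable {ν : ℕ} {Γ : Set (Fin ν → ℤ)}

theorem latticeDist_le_latticeDiam {X : Finset Γ} {x y : Γ} (hx : x ∈ X) (hy : y ∈ X) :
    latticeDist x.1 y.1 ≤ latticeDiam X :=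
  (Finset.le_sup (f := fun y : Γ => latticeDist x.1 y.1) hy).trans
    (Finset.le_sup (f := fun x : Γ => X.sup fun y => latticeDist x.1 y.1) hx)

/-- Balls in the lattice are finite, with a cardinality that is bounded uniformly in the centre. -/
theorem exists_ball_card_le (Γ : Set (Fin ν → ℤ)) (r : ℝ) :
    ∃ C : ℕ, ∀ x : Γ, {y : Γ | (latticeDist x.1 y.1 : ℝ) ≤ r}.Finite ∧
      {y : Γ | (latticeDist x.1 y.1 : ℝ) ≤ r}.ncard ≤ C := by
  set Q : Finset (Fin ν → ℤ) := Fintype.piFinset fun _ => Finset.Icc (-⌊r⌋) ⌊r⌋ with hQ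
  refine ⟨Q.card, fun x => ?_⟩
  have hmaps : ∀ y ∈ {y : Γ | (latticeDist x.1 y.1 : ℝ) ≤ r},
      x.1 - y.1 ∈ (Q : Set (Fin ν → ℤ)) := by
    intro y hy
    rw [Finset.mem_coe, Fintype.mem_piFinset]
    intro j
    have h1 : (x.1 j - y.1 j).natAbs ≤ latticeDist x.1 y.1 :=
      Finset.single_le_sum (f := fun j => (x.1 j - y.1 j).natAbs) (fun _ _ => Nat.zero_le _)
        (Finset.mem_univ j)
    have h2 : ((latticeDist x.1 y.1 : ℕ) : ℤ) ≤ ⌊r⌋ := Int.le_floor.mpr (by exact_mod_cast hy)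
    rw [Finset.mem_Icc, Pi.sub_apply]
    omega
  have hinj : Set.InjOn (fun y : Γ => x.1 - y.1) {y : Γ | (latticeDist x.1 y.1 : ℝ) ≤ r} :=
    fun y _ z _ h => Subtype.ext (sub_right_injective h)
  refine ⟨Set.Finite.of_injOn hmaps hinj Q.finite_toSet, ?_⟩
  rw [← Set.ncard_coe_finset]
  exact Set.ncard_le_ncard_of_injOn _ hmaps hinj Q.finite_toSet

theorem card_le_ballSize {r : ℝ} {X : Finset Γ} (hX : X.Nonempty)
    (hr : (latticeDiam X : ℝ) ≤ r) : X.card ≤ ballSize Γ r := by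
  obtain ⟨x, hx⟩ := hX
  obtain ⟨C, hC⟩ := exists_ball_card_le Γ r
  refine le_trans ?_ (le_ciSup (f := fun x : Γ => {y : Γ | (latticeDist x.1 y.1 : ℝ) ≤ r}.ncard)
    ⟨C, by rintro _ ⟨x, rfl⟩; exact (hC x).2⟩ x)
  rw [← Set.ncard_coe_finset]
  refine Set.ncard_le_ncard (fun y hy => ?_) (hC x).1
  exact le_trans (by exact_mod_cast latticeDist_le_latticeDiam hx hy) hr

/-- A set that meets both `L` and its complement and has diameter at most `r` lies in the
interaction boundary. -/
theorem subset_of_diam_le {r : ℝ} {Λ L B X : Finset Γ}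
    (hB : interactionBoundary r Λ L ⊆ (B : Set Γ)) (hX : X ⊆ Λ) (hr : (latticeDiam X : ℝ) ≤ r)
    (hL : ¬ X ⊆ L) (hLc : ¬ X ⊆ Λ \ L) : X ⊆ B := by
  obtain ⟨y, hyX, hyL⟩ := Finset.not_subset.mp hL
  obtain ⟨x, hxX, hxL⟩ := Finset.not_subset.mp hLc
  have hxL' : x ∈ L := by
    by_contra h
    exact hxL (Finset.mem_sdiff.mpr ⟨hX hxX, h⟩)
  have hdist : ∀ u ∈ X, ∀ v ∈ X, (latticeDist u.1 v.1 : ℝ) ≤ r := fun u hu v hv =>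
    le_trans (by exact_mod_cast latticeDist_le_latticeDiam hu hv) hr
  intro z hz
  apply hB
  by_cases hzL : z ∈ L
  · exact Or.inl ⟨hzL, y, Finset.mem_sdiff.mpr ⟨hX hyX, hyL⟩, hdist z hz y hyX⟩
  · exact Or.inr ⟨Finset.mem_sdiff.mpr ⟨hX hz, hzL⟩, x, hxL', hdist z hz x hxX⟩

end Lattice

/-! ### The Hamiltonians of a finite-range interaction -/

namespace Interaction

variable {ν d : ℕ} {Γ : Set (Fin ν → ℤ)} (Φ : Interaction Γ d)

theorem sum_norm_le_strength (h : Φ.strength < ⊤) (S : Finset (Finset Γ)) (x : Γ) :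
    ∑ Z ∈ S with x ∈ Z, ‖Φ.val Z‖ ≤ Φ.strength.toReal := by
  rw [← ENNReal.ofReal_le_iff_le_toReal h.ne,
    ENNReal.ofReal_sum_of_nonneg fun _ _ => norm_nonneg _]
  calc _ = ∑ Z ∈ S.subtype (fun Z => x ∈ Z), ‖Φ.val Z.1‖ₑ := by
        rw [← Finset.sum_subtype_eq_sum_filter]
        exact Finset.sum_congr rfl fun Z _ => ofReal_norm _
    _ ≤ ∑' Z : {Z : Finset Γ // x ∈ Z}, ‖Φ.val Z.1‖ₑ := ENNReal.sum_le_tsum _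
    _ ≤ Φ.strength :=
        le_iSup (fun x : Γ => ∑' Z : {Z : Finset Γ // x ∈ Z}, ‖Φ.val Z.1‖ₑ) x

theorem partialSum_eq_sum_attach {Λ : Finset Γ} {S : Finset (Finset Γ)} (hS : ∀ Z ∈ S, Z ⊆ Λ) :
    Φ.partialSum Λ S = ∑ Z ∈ S.attach, embed (hS Z.1 Z.2) (Φ.val Z.1) := by
  rw [partialSum, ← Finset.sum_attach]
  exact Finset.sum_congr rfl fun Z _ => dif_pos (hS Z.1 Z.2)

theorem isSelfAdjoint_partialSum (Λ : Finset Γ) (S : Finset (Finset Γ)) :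
    IsSelfAdjoint (Φ.partialSum Λ S) := by
  refine isSelfAdjoint_sum _ fun Z _ => ?_
  split_ifs with h
  · exact (embed_conjTranspose h _).symm.trans (congrArg (embed h) (Φ.isHermitian Z))
  · exact IsSelfAdjoint.zero _

theorem boundaryHam_eq_embed {Λ B : Finset Γ} (hB : B ⊆ Λ) :
    Φ.boundaryHam Λ B = embed hB (Φ.hamiltonian B) := by
  change _ = embedHom hB _
  rw [boundaryHam, hamiltonian,
    Φ.partialSum_eq_sum_attach fun Z hZ => (Finset.mem_powerset.mp hZ).trans hB,
    Φ.partialSum_eq_sum_attach fun Z hZ => Finset.mem_powerset.mp hZ, map_sum]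
  exact Finset.sum_congr rfl fun Z _ => (embed_embed _ hB _).symm

theorem norm_boundaryHam_le {Λ B : Finset Γ} (hB : B ⊆ Λ) :
    ‖Φ.boundaryHam Λ B‖ ≤ Φ.boundaryNorm B := by
  rw [boundaryHam_eq_embed Φ hB]
  exact norm_embed_le hB _

/-- The sets `Z` contributing to the bulk Hamiltonian `H'_L + H'_{L^c}`. -/
def bulkSets (Λ L B : Finset Γ) : Finset (Finset Γ) :=
  (L.powerset.filter fun Z => ¬ Z ⊆ B) ∪ ((Λ \ L).powerset.filter fun Z => ¬ Z ⊆ B)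

theorem subset_of_mem_bulkSets {Λ L B Z : Finset Γ} (hL : L ⊆ Λ) (hZ : Z ∈ bulkSets Λ L B) :
    Z ⊆ Λ := by
  rcases Finset.mem_union.mp hZ with h | h
  · exact (Finset.mem_powerset.mp (Finset.mem_filter.mp h).1).trans hL
  · exact (Finset.mem_powerset.mp (Finset.mem_filter.mp h).1).trans Finset.sdiff_subset

theorem bulkHam_add_bulkHam (Λ L B : Finset Γ) :
    Φ.bulkHam Λ B L + Φ.bulkHam Λ B (Λ \ L) = Φ.partialSum Λ (bulkSets Λ L B) := by
  rw [bulkHam, bulkHam, partialSum, partialSum, partialSum, bulkSets, Finset.sum_union]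
  refine Finset.disjoint_left.mpr fun Z h1 h2 => ?_
  -- Only the empty set lies in both `L` and its complement, and it lies in `B` as well.
  simp only [Finset.mem_filter, Finset.mem_powerset] at h1 h2
  exact h1.2 fun z hz => absurd (h1.1 hz) (Finset.mem_sdiff.mp (h2.1 hz)).2

theorem hamiltonian_eq_boundaryHam_add {r : ℝ} (hrange : Φ.HasRange r) {Λ L B : Finset Γ}
    (hL : L ⊆ Λ) (hB : B ⊆ Λ) (hboundary : interactionBoundary r Λ L ⊆ (B : Set Γ)) :
    Φ.hamiltonian Λ =
      Φ.boundaryHam Λ B + (Φ.bulkHam Λ B L + Φ.bulkHam Λ B (Λ \ L)) := by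
  have hdisj : Disjoint B.powerset (bulkSets Λ L B) := by
    refine Finset.disjoint_left.mpr fun Z h1 h2 => ?_
    rcases Finset.mem_union.mp h2 with h | h
    · exact (Finset.mem_filter.mp h).2 (Finset.mem_powerset.mp h1)
    · exact (Finset.mem_filter.mp h).2 (Finset.mem_powerset.mp h1)
  rw [bulkHam_add_bulkHam, boundaryHam, hamiltonian, partialSum, partialSum, partialSum,
    ← Finset.sum_union hdisj]
  refine (Finset.sum_subset ?_ fun Z hZ hZ' => ?_).symm
  · intro Z hZ
    rcases Finset.mem_union.mp hZ with h | h
    · exact Finset.mem_powerset.mpr ((Finset.mem_powerset.mp h).trans hB)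
    · exact Finset.mem_powerset.mpr (subset_of_mem_bulkSets hL h)
  · have hZΛ := Finset.mem_powerset.mp hZ
    have hzero : Φ.val Z = 0 := by
      refine hrange Z (lt_of_not_ge fun hr => hZ' ?_)
      by_cases hZB : Z ⊆ B
      · exact Finset.mem_union_left _ (Finset.mem_powerset.mpr hZB)
      refine Finset.mem_union_right _ ?_
      by_cases hZL : Z ⊆ L
      · exact Finset.mem_union_left _ (by simp [hZL, hZB])
      by_cases hZc : Z ⊆ Λ \ L
      · exact Finset.mem_union_right _ (Finset.mem_filter.mpr ⟨Finset.mem_powerset.mpr hZc, hZB⟩)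
      exact absurd (subset_of_diam_le hboundary hZΛ hr hZL hZc) hZB
    rw [dif_pos hZΛ, hzero, embed_zero]

theorem rate_nonneg (r : ℝ) (B : Finset Γ) : 0 ≤ Φ.rate r B := by
  unfold rate
  positivity

/-- Up to imaginary time `λ`, conjugation by the bulk dynamics at most doubles the boundary
Hamiltonian in norm. -/
theorem norm_exp_conj_boundaryHam_le {r : ℝ} (hrange : Φ.HasRange r) (hbounded : Φ.strength < ⊤)
    {Λ L B : Finset Γ} (hL : L ⊆ Λ) (hB : B ⊆ Λ) {t : ℝ} (ht : 0 ≤ t) (htl : t ≤ Φ.rate r B) :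
    ‖NormedSpace.exp (t • (Φ.bulkHam Λ B L + Φ.bulkHam Λ B (Λ \ L))) * Φ.boundaryHam Λ B *
      NormedSpace.exp (-(t • (Φ.bulkHam Λ B L + Φ.bulkHam Λ B (Λ \ L))))‖ ≤
      2 * Φ.boundaryNorm B := by
  set c : ℝ := 2 * Φ.strength.toReal * ((ballSize Γ r : ℝ) + (B.card : ℝ)) with hc
  have hc0 : 0 ≤ c := by positivity
  have htc : t * c ≤ 1 / 2 := by
    refine (mul_le_mul_of_nonneg_right htl hc0).trans ?_
    have hrate : Φ.rate r B = 1 / (2 * c) := by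
      rw [rate, hc]
      congr 1
      ring
    -- If `c = 0` then `λ` is `1 / 0 = 0`, and the bound holds trivially.
    rcases hc0.eq_or_lt with h | h
    · rw [← h]
      norm_num
    · rw [hrate]
      exact le_of_eq (by field_simp)
  have hsupp : SupportedOn B (Φ.boundaryHam Λ B) := by
    rw [boundaryHam_eq_embed Φ hB]
    exact supportedOn_embed hB _
  refine (norm_exp_conj_le (c := c) (fun m => ?_) ht hc0 htc).trans
    (mul_le_mul_of_nonneg_left (Φ.norm_boundaryHam_le hB) zero_le_two)
  have hS : ∀ Z ∈ bulkSets Λ L B, Z ⊆ Λ := fun Z hZ => subset_of_mem_bulkSets hL hZ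
  refine norm_adCLM_pow_apply_le_factorial (bulkSets Λ L B) Φ.val hS _ ?_ ?_
    (Φ.sum_norm_le_strength hbounded _) ENNReal.toReal_nonneg hsupp m
  · rw [bulkHam_add_bulkHam, Φ.partialSum_eq_sum_attach hS]
  · intro Z _ hne hZ
    exact card_le_ballSize hne (not_lt.mp fun h => hZ (hrange Z h))

end Interaction

/-- The eigenvectors of an ordered eigensystem form an orthonormal basis, since there are as many
of them as the dimension. -/
theorem IsOrderedEigensystem.exists_orthonormalBasis {V : Type*} [DecidableEq V] {d : ℕ}
    {Λ : Finset V} {A : Obs d Λ} {ε : Fin (d ^ Λ.card) → ℝ} {ψ : Fin (d ^ Λ.card) → Hilb d Λ}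
    (h : IsOrderedEigensystem A ε ψ) :
    ∃ β : OrthonormalBasis (Fin (d ^ Λ.card)) ℂ (Hilb d Λ), (∀ i, β i = ψ i) ∧
      ∀ i, op A (β i) = (ε i : ℂ) • β i := by
  have hcard : Module.finrank ℂ (Hilb d Λ) = Fintype.card (Fin (d ^ Λ.card)) := by
    rw [finrank_euclideanSpace]
    simp
  obtain ⟨β, hβ⟩ := Orthonormal.exists_orthonormalBasis_extension_of_card_eq hcard
    (v := ψ) (s := Set.univ) (h.orthonormal.comp _ Subtype.val_injective)
  refine ⟨β, fun i => hβ i trivial, fun i => ?_⟩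
  rw [hβ i trivial, ← h.eigen i]
  rfl

end SpinSystem

end

theorem theorem3p2 {ν d : ℕ} {Γ : Set (Fin ν → ℤ)} (Φ : SpinSystem.Interaction Γ d)
    (r : ℝ) (hrange : Φ.HasRange r) (hbounded : Φ.strength < ⊤)
    (Λ L B : Finset Γ) (hL : L ⊆ Λ) (hB : B ⊆ Λ)
    (hboundary : SpinSystem.interactionBoundary r Λ L ⊆ (B : Set Γ))
    (M : ℝ) (hM : Φ.boundaryNorm B < M)
    (ε ε' : Fin (d ^ Λ.card) → ℝ) (ψ ψ' : Fin (d ^ Λ.card) → SpinSystem.Hilb d Λ)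
    (hH : SpinSystem.IsOrderedEigensystem (Φ.hamiltonian Λ) ε ψ)
    (hlowest : IsLeast (Set.range ε) 0)
    (hH' : SpinSystem.IsOrderedEigensystem (Φ.truncatedHam Λ L B M) ε' ψ') :
    (∀ j, ε j - 2 * Φ.deltaErr r B M (ε j) ≤ ε' j ∧ ε' j ≤ ε j) ∧
    (∀ (i₀ i₁ : Fin (d ^ Λ.card)), i₀.val = 0 → i₁.val = 1 →
      ∀ (Δ δ₀ η : ℝ), Δ = ε i₁ → δ₀ = Φ.deltaErr r B M (ε i₀) →
        η = Φ.etaErr r B M (2 * δ₀) Δ → 2 * δ₀ + η < Δ →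
        1 - ((2 * δ₀ + η) / Δ) ^ 2 ≤ ‖inner ℂ (ψ i₀) (ψ' i₀)‖ ^ 2) := by
  obtain ⟨β, hβψ, hβ⟩ := hH.exists_orthonormalBasis
  obtain ⟨β', hβψ', hβ'⟩ := hH'.exists_orthonormalBasis
  set a := Φ.boundaryHam Λ B with ha_def
  set K := Φ.bulkHam Λ B L + Φ.bulkHam Λ B (Λ \ L) with hK_def
  set b := Φ.boundaryNorm B with hb_def
  set l := Φ.rate r B with hl_def
  have ha : IsSelfAdjoint a := Φ.isSelfAdjoint_partialSum _ _
  have hK : IsSelfAdjoint K :=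
    (Φ.isSelfAdjoint_partialSum _ _).add (Φ.isSelfAdjoint_partialSum _ _)
  have hab : ‖a‖ ≤ b := Φ.norm_boundaryHam_le hB
  have hb : 0 ≤ b := (norm_nonneg a).trans hab
  have hl : 0 ≤ l := Φ.rate_nonneg r B
  have hconj : ∀ t, 0 ≤ t → t ≤ l →
      ‖NormedSpace.exp (t • K) * a * NormedSpace.exp (-(t • K))‖ ≤ 2 * b :=
    fun t h0 h1 => Φ.norm_exp_conj_boundaryHam_le hrange hbounded hL hB h0 h1
  have hpos : ∀ i, 0 ≤ ε i := fun i => hlowest.2 ⟨i, rfl⟩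
  rw [Φ.hamiltonian_eq_boundaryHam_add hrange hL hB hboundary] at hβ
  have hform : ∀ v, 0 ≤ (inner ℂ v (SpinSystem.op (a + K) v)).re := fun v => by
    simpa using SpinSystem.le_re_inner_op (ha.add hK) hβ (e := 0) (v := v)
      fun i hi => absurd (hpos i) (not_le.mpr hi)
  have hcut : Φ.truncatedHam Λ L B M = a + SpinSystem.cutoff M K :=
    congrArg (a + ·) (SpinSystem.energyTruncation_eq_cutoff hK fun x hx =>
      SpinSystem.neg_lt_of_mem_spectrum hK (hab.trans_lt hM) hform hx)
  rw [hcut] at hβ'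
  have hM0 : 0 < M := hb.trans_lt hM
  have hsqrt : 1 ≤ √(2 : ℝ) := Real.one_le_sqrt.mpr one_le_two
  have hupper : ∀ j, ε' j ≤ ε j :=
    SpinSystem.truncated_eigenvalue_le hK ha hH.monotone hβ hH'.monotone hβ'
  have hlower : ∀ j, ε j - 2 * Φ.deltaErr r B M (ε j) ≤ ε' j := by
    intro j
    refine le_trans ?_ (SpinSystem.eigenvalue_sub_le_truncated hK ha hab hM.le hl hconj
      hH.monotone hβ hH'.monotone hβ' (hpos j))
    have hj := hpos j
    have h1 : Real.exp (-l * (M - ε' j - 3 * b)) ≤ Real.exp (-l * (M - 2 * ε j - 18 * b)) :=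
      Real.exp_le_exp.mpr (by nlinarith [hupper j, mul_nonneg hl hb, mul_nonneg hl hj,
        mul_le_mul_of_nonneg_left (hupper j) hl])
    have h2 : ε j + 2 * b ≤ 2 * (2 * √2 * (M + 5 * b + ε j)) := by nlinarith
    have h3 := mul_le_mul h2 h1 (Real.exp_pos _).le (by positivity)
    have h4 : 2 * Φ.deltaErr r B M (ε j) =
        2 * (2 * √2 * (M + 5 * b + ε j)) * Real.exp (-l * (M - 2 * ε j - 18 * b)) :=
      (mul_assoc 2 _ _).symm
    linarith
  refine ⟨fun j => ⟨hlower j, hupper j⟩, ?_⟩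
  -- The overlap bound is needed only with `q = 2√2 e^{-λ (M - 4δ₀ - 10b)}`, for which
  -- `(M + b + Δ) q = η`.
  intro i₀ i₁ h0 h1 Δ δ₀ η hΔ hδ hη hlt
  have hε0 : ε i₀ = 0 := by
    obtain ⟨k, hk⟩ := hlowest.1
    refine le_antisymm ?_ (hpos i₀)
    rw [← hk]
    exact hH.monotone (Fin.le_def.mpr (by omega))
  have hgap : ∀ i, i ≠ i₀ → Δ ≤ ε i := by
    intro i hi
    rw [hΔ]
    refine hH.monotone (Fin.le_def.mpr ?_)
    have : i.val ≠ i₀.val := fun h => hi (Fin.ext h)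
    omega
  have hΔ0 : 0 ≤ Δ := hΔ ▸ hpos i₁
  have hδ0 : 0 ≤ δ₀ := by
    rw [hδ, hε0, SpinSystem.Interaction.deltaErr]
    positivity
  set E := Real.exp (-l * (M - 2 * (2 * δ₀) - 10 * b)) with hE
  have hη' : η = 2 * √2 * (M + b + Δ) * E := hη
  have hη0 : 0 ≤ η := by
    rw [hη']
    positivity
  have hΔpos : 0 < Δ := by linarith
  have he : |ε' i₀| ≤ 2 * δ₀ := by
    have h2 := hlower i₀
    have h3 := hupper i₀
    rw [← hδ, hε0] at h2
    rw [hε0] at h3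
    rw [abs_of_nonpos h3]
    linarith
  have hφ : ‖β' i₀‖ = 1 := β'.orthonormal.1 i₀
  have hq : ‖SpinSystem.op (SpinSystem.highProj M K) (β' i₀)‖ ≤ 2 * √2 * E := by
    have h2 := SpinSystem.norm_highProj_apply_le hK ha hab hl hconj hβ' (e := ε' i₀)
      (φ := β' i₀) fun i hi => β'.inner_eq_zero fun h => hi.ne (by rw [h])
    rw [hφ, mul_one] at h2
    have h3 : Real.exp (-l * (M - ε' i₀ - 3 * b)) ≤ E := by
      refine Real.exp_le_exp.mpr ?_
      have h4 : ε' i₀ ≤ 0 := hε0 ▸ hupper i₀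
      nlinarith [mul_nonneg hl hb, mul_nonneg hl hδ0, mul_nonneg hl (neg_nonneg.mpr h4)]
    have h5 : 1 * E ≤ 2 * √2 * E := by
      gcongr
      linarith
    linarith
  have hmain := SpinSystem.one_sub_sq_le_overlap hK ha hab hM0.le hβ hΔpos hgap hφ (hβ' i₀) he hq
  rw [← hβψ, ← hβψ']
  convert hmain using 4
  rw [hη']
  ring
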